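/- Let $d\ge 1$ and $0<q<\frac{d+4}{d+2}$. Let $\ln_q t=\frac{t^{1-q}-1}{1-q}$ and $\exp_q(t)=[1+(1-q)t]_+^{1/(1-q)}$ for $q\neq1$, and $\ln_1=\ln$, $\exp_1=\exp$. Put $C_1(q,d)=\frac{2}{2+(d+2)(1-q)}$, $$C_0(q,d)=\begin{cases}\frac{\Gamma\left(\frac{2-q}{1-q}+\frac d2\right)}{\Gamma\left(\frac{2-q}{1-q}\right)}\left(\frac{(1-q)C_1(q,d)}{2\pi}\right)^{d/2},&0<q<1,\\ (2\pi)^{-d/2},&q=1,\\ \frac{\Gamma\left(\frac{1}{q-1}\right)}{\Gamma\left(\frac{1}{q-1}-\frac d2\right)}\left(\frac{(q-1)C_1(q,d)}{2\pi}\right)^{d/2},&1<q<\frac{d+4}{d+2},\end{cases}\qquad m(q,d)=\frac{2(2-q)\,C_0(q,d)^{1-q}}{2+(d+2)(1-q)}.$$ For $v\in\mathbb R^d$ and a real symmetric positive definite $d\times d$ matrix $V$, the $q$-Gaussian measure $G_q(v,V)$ is the measure on $\mathbb R^d$ with Lebesgue density $C_0(q,d)(\det V)^{-1/2}\exp_q\left(-\tfrac12C_1(q,d)\langle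 x-v,V^{-1}(x-v)\rangle\right)$. Let $\mathcal G_q$ be the set of all these measures. Let $W_2$ be the $L^2$-Wasserstein distance, and for $\mu\in\mathcal G_q$ (with density also written $\mu$) let $F_q(\mu)=\int_{\mathbb R^d}\mu(x)\ln_q\mu(x)\,dx$ be the Tsallis entropy functional; this integral converges absolutely for every $\mu\in\mathcal G_q$. Let $0<\alpha\le\beta$. Consider data consisting of weights $\lambda_1,\dots,\lambda_n\ge0$ with $\sum_i\lambda_i=1$ and symmetric matrices $A_1,\dots,A_n$ with $\alpha I\le A_i\le\beta I$ in the Loewner order for all $i$; put $\mu_i=G_q(0,A_i)$. For $\gamma\ge0$ consider the problem $$\min_{\mu\in\mathcal G_q}\ \sum_{i=1}^n\tfrac12\lambda_iW_2^2(\mu,\mu_i)+\gamma F_q(\mu).\tag{$*$}$$ (a) If $0<q\le1$, or if $1<q\le1+\frac{2\alpha^2}{d\beta^2}$, then for all such data and all $\gamma\ge0$ the problem $(*)$ has a unique solution. (b) If $1+\frac{2\alpha^2}{d\beta^2}<q$ (and $q<\frac{d+4}{d+2}$ as above), then there is $\gamma_0>0$, depending only on $d,q,\alpha,\beta$, such that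 for all such data and all $0\le\gamma<\gamma_0$ the problem $(*)$ has a unique solution. In both cases the solution is $G_q(0,X)$ with $X$ positive definite, and $X$, which is the covariance matrix of the solution, solves $$X-\gamma\,m(q,d)\,(\det X)^{\frac{q-1}{2}}I=\sum_{i=1}^n\lambda_i\left(X^{1/2}A_iX^{1/2}\right)^{1/2}.$$ -/

import Mathlib

open MeasureTheory ProbabilityTheory Matrix
open scoped ENNReal MatrixOrder

noncomputable section

/-- The `q`-logarithm `(t^(1-q) - 1)/(1-q)`, which is the natural logarithm for `q = 1`. -/
def qLog (q t : ℝ) : ℝ :=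
  if q = 1 then Real.log t else (t ^ (1 - q) - 1) / (1 - q)

/-- The `q`-exponential `[1 + (1-q) t]_+ ^ (1/(1-q))`, which is `exp` for `q = 1`.
It is only used at `t ≤ 0`; there the base of the power is at least `1` if `q > 1`, so that the
value `∞` (for `q > 1` and `1 + (1-q) t ≤ 0`) never occurs. -/
def qExp (q t : ℝ) : ℝ :=
  if q = 1 then Real.exp t else (max 0 (1 + (1 - q) * t)) ^ (1 / (1 - q))

/-- The constant `C₁(q,d)`. -/
def qC1 (q : ℝ) (d : ℕ) : ℝ := 2 / (2 + ((d : ℝ) + 2) * (1 - q))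

/-- The normalization constant `C₀(q,d)`; for `q = 1` it is that of the Gaussian density. -/
def qC0 (q : ℝ) (d : ℕ) : ℝ :=
  if q < 1 then
    Real.Gamma ((2 - q) / (1 - q) + (d : ℝ) / 2) / Real.Gamma ((2 - q) / (1 - q)) *
      ((1 - q) * qC1 q d / (2 * Real.pi)) ^ ((d : ℝ) / 2)
  else if 1 < q then
    Real.Gamma (1 / (q - 1)) / Real.Gamma (1 / (q - 1) - (d : ℝ) / 2) *
      ((q - 1) * qC1 q d / (2 * Real.pi)) ^ ((d : ℝ) / 2)
  else (1 / (2 * Real.pi)) ^ ((d : ℝ) / 2)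

/-- The constant `m(q,d)`. -/
def qM (q : ℝ) (d : ℕ) : ℝ :=
  2 * (2 - q) * qC0 q d ^ (1 - q) / (2 + ((d : ℝ) + 2) * (1 - q))

/-- The density of the `q`-Gaussian measure with mean `v` and covariance matrix `V`. -/
def qGaussianPDF {d : ℕ} (q : ℝ) (v : EuclideanSpace ℝ (Fin d)) (V : Matrix (Fin d) (Fin d) ℝ)
    (x : EuclideanSpace ℝ (Fin d)) : ℝ :=
  qC0 q d * V.det ^ (-(1 / 2) : ℝ) *
    qExp q (-(1 / 2) * qC1 q d *
      (WithLp.ofLp (x - v) ⬝ᵥ (V⁻¹ *ᵥ WithLp.ofLp (x - v))))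

/-- The `q`-Gaussian measure `G_q(v, V)`. -/
def qGaussian {d : ℕ} (q : ℝ) (v : EuclideanSpace ℝ (Fin d)) (V : Matrix (Fin d) (Fin d) ℝ) :
    Measure (EuclideanSpace ℝ (Fin d)) :=
  volume.withDensity fun x => ENNReal.ofReal (qGaussianPDF q v V x)

/-- The set of all `q`-Gaussian measures on `ℝ^d` (all means, all positive definite
covariance matrices). -/
def qGaussians (d : ℕ) (q : ℝ) : Set (Measure (EuclideanSpace ℝ (Fin d))) :=
  {μ | ∃ (v : EuclideanSpace ℝ (Fin d)) (V : Matrix (Fin d) (Fin d) ℝ),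
    V.PosDef ∧ μ = qGaussian q v V}

/-- The squared `L²`-Wasserstein distance: the infimum of the quadratic cost over all
transport plans between `μ` and `ν`. -/
def wassersteinSq {d : ℕ} (μ ν : Measure (EuclideanSpace ℝ (Fin d))) : ℝ≥0∞ :=
  ⨅ π ∈ {π : Measure (EuclideanSpace ℝ (Fin d) × EuclideanSpace ℝ (Fin d)) |
      IsProbabilityMeasure π ∧ π.map Prod.fst = μ ∧ π.map Prod.snd = ν},
    ∫⁻ p, ENNReal.ofReal (‖p.1 - p.2‖ ^ 2) ∂π

/-- The integrand `μ(x) ln_q μ(x)` of the Tsallis entropy, `μ(x)` being the Lebesgue density. -/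
def tsallisIntegrand {d : ℕ} (q : ℝ) (μ : Measure (EuclideanSpace ℝ (Fin d)))
    (x : EuclideanSpace ℝ (Fin d)) : ℝ :=
  (μ.rnDeriv volume x).toReal * qLog q (μ.rnDeriv volume x).toReal

/-- The Tsallis entropy functional `F_q(μ) = ∫ μ ln_q μ`. -/
def tsallisEntropy {d : ℕ} (q : ℝ) (μ : Measure (EuclideanSpace ℝ (Fin d))) : ℝ :=
  ∫ x, tsallisIntegrand q μ x

/-- The penalized objective `∑ i, (1/2) w_i W_2²(μ, μ_i) + γ F_q(μ)`. -/
def penalizedObjective {d n : ℕ} (q γ : ℝ) (w : Fin n → ℝ)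
    (μs : Fin n → Measure (EuclideanSpace ℝ (Fin d)))
    (μ : Measure (EuclideanSpace ℝ (Fin d))) : EReal :=
  ((∑ i, ENNReal.ofReal (1 / 2 * w i) * wassersteinSq μ (μs i) : ℝ≥0∞) : EReal) +
    ((γ * tsallisEntropy q μ : ℝ) : EReal)

/-- `μ` minimizes the penalized objective over the set of all `q`-Gaussian measures. -/
def IsPenalizedBarycenter {d n : ℕ} (q γ : ℝ) (w : Fin n → ℝ)
    (μs : Fin n → Measure (EuclideanSpace ℝ (Fin d)))
    (μ : Measure (EuclideanSpace ℝ (Fin d))) : Prop :=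
  μ ∈ qGaussians d q ∧
    ∀ ν ∈ qGaussians d q, penalizedObjective q γ w μs μ ≤ penalizedObjective q γ w μs ν

/-- The minimization problem with data `μ_i = G_q(0, A_i)` has exactly one solution, which is
`G_q(0, X)` for some positive definite `X`; this `X` is its covariance matrix and solves
`X - γ m(q,d) (det X)^((q-1)/2) I = ∑ i, w_i (X^(1/2) A_i X^(1/2))^(1/2)`. -/
def HasUniqueQGaussianBarycenter {d n : ℕ} (q γ : ℝ) (w : Fin n → ℝ)
    (A : Fin n → Matrix (Fin d) (Fin d) ℝ) : Prop :=
  ∃ X : Matrix (Fin d) (Fin d) ℝ, X.PosDef ∧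
    IsPenalizedBarycenter q γ w (fun i => qGaussian q 0 (A i)) (qGaussian q 0 X) ∧
    (∀ ν : Measure (EuclideanSpace ℝ (Fin d)),
      IsPenalizedBarycenter q γ w (fun i => qGaussian q 0 (A i)) ν → ν = qGaussian q 0 X) ∧
    (∀ i j : Fin d, covariance (fun x : EuclideanSpace ℝ (Fin d) => x i)
      (fun x : EuclideanSpace ℝ (Fin d) => x j) (qGaussian q 0 X) = X i j) ∧
    X - (γ * qM q d * X.det ^ ((q - 1) / 2)) • (1 : Matrix (Fin d) (Fin d) ℝ) =
      ∑ i, w i • CFC.sqrt (CFC.sqrt X * A i * CFC.sqrt X)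

end

/-! Every q-Gaussian is an affine image of the rotation-invariant law `qGaussian q 0 1`, and `qC1`
is chosen so that this law has identity covariance. Two consequences turn the problem into one about
matrices. The optimal map to a centred q-Gaussian is affine, so W₂² is |v|² + tr Y + tr A - 2
tr(TY), where T is the positive definite solution of TYT = A (`wassersteinSq_qGaussian`). The
Tsallis entropy depends on the determinant of the covariance only (`tsallis_qGaussian`). Hence the
objective splits as |v|²/2 + f(X) with f = `matrixObjective`; the mean must vanish and f remains to
be minimized over positive definite X.

The function f is convex along straight segments of matrices. Indeed 2 tr(TY) is the minimum over
positive definite W of the affine functions tr(WY) + tr(W⁻¹A) (`two_mul_trace_le`). As for the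
entropy, d(q-1)/2 ≤ 1, so Bernoulli's inequality and AM-GM place it above its tangent at every X
(`qEntropyOfDet_det_sub_ge`). So a positive definite X satisfying the first-order equation is a
global minimizer. It is the only one, because equality in the trace bound forces equal transport
matrices, which determine the covariance (`eq_of_matrixObjective_le_of_stationary`). The argument is
uniform in q and γ.

A stationary point is found by minimizing f over the compact set εI ≤ X ≤ RI (`exists_stationary`).
If X had eigenvalue ε or R, moving that eigenvalue inwards would decrease f, so the minimizer is
interior and all first variations vanish. The matrix square root is never differentiated: lower
semicontinuity comes from the affine bounds above, and first variations from suboptimal couplings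
(`matrixObjective_congrPath_le`). -/

/-! ### Beta integrals and radial integration. -/

theorem integral_Ioo_rpow_mul_one_sub_rpow {x y : ℝ} (hx : 0 < x) (hy : 0 < y) :
    ∫ u in Set.Ioo (0 : ℝ) 1, u ^ (x - 1) * (1 - u) ^ (y - 1) = beta x y := by
  have hb := beta_pos hx hy
  have h := lintegral_betaPDF_eq_one hx hy
  rw [lintegral_betaPDF, ← ENNReal.toReal_eq_one_iff, ← integral_eq_lintegral_of_nonneg_ae] at h
  · simp_rw [mul_assoc, integral_const_mul] at h
    field_simp at h
    exact h
  · refine ae_restrict_of_forall_mem measurableSet_Ioo fun u hu => ?_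
    have : 0 < 1 - u := by linarith [hu.2]
    have := hu.1
    simp only [Pi.zero_apply]
    positivity
  · exact Measurable.aestronglyMeasurable (by fun_prop)

theorem integral_Ioi_rpow_mul_max_one_sub_rpow {x p : ℝ} (hx : 0 < x) (hp : 0 < p) :
    ∫ u in Set.Ioi (0 : ℝ), u ^ (x - 1) * (max 0 (1 - u)) ^ p = beta x (p + 1) := by
  have hp1 : 0 < p + 1 := by linarith
  rw [← integral_Ioo_rpow_mul_one_sub_rpow hx hp1, add_sub_cancel_right,
    setIntegral_eq_of_subset_of_forall_sdiff_eq_zero measurableSet_Ioi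
      (show Set.Ioo (0 : ℝ) 1 ⊆ Set.Ioi 0 from Set.Ioo_subset_Ioi_self)]
  · refine setIntegral_congr_fun measurableSet_Ioo fun u hu => ?_
    rw [max_eq_right (by linarith [hu.2])]
  · rintro u ⟨hu0, hu1⟩
    have : 1 ≤ u := not_lt.1 fun h => hu1 ⟨hu0, h⟩
    rw [max_eq_left (by linarith), Real.zero_rpow hp.ne', mul_zero]

/-- The substitution u = t/(1-t) maps (0,1) onto (0,∞), with 1 + u = (1-t)⁻¹ and Jacobian (1-t)⁻²,
and produces the Euler integral. -/
theorem integral_Ioi_rpow_mul_one_add_rpow_neg {x p : ℝ} (hx : 0 < x) (hp : x < p) :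
    ∫ u in Set.Ioi (0 : ℝ), u ^ (x - 1) * (1 + u) ^ (-p) = beta x (p - x) := by
  have hy : 0 < p - x := by linarith
  have him : (fun t : ℝ => t / (1 - t)) '' Set.Ioo 0 1 = Set.Ioi 0 := by
    ext u
    constructor
    · rintro ⟨t, ht, rfl⟩
      exact div_pos ht.1 (by linarith [ht.2])
    · intro hu
      have hu : 0 < u := hu
      refine ⟨u / (1 + u), ⟨by positivity, by rw [div_lt_one (by positivity)]; linarith⟩, ?_⟩
      field_simp
      ring
  have hder : ∀ t ∈ Set.Ioo (0 : ℝ) 1, HasDerivWithinAt (fun t : ℝ => t / (1 - t))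
      (1 / (1 - t) ^ 2) (Set.Ioo 0 1) t := by
    intro t ht
    have ht' : 1 - t ≠ 0 := by linarith [ht.2]
    have := ((hasDerivAt_id t).div ((hasDerivAt_id t).const_sub 1) ht').hasDerivWithinAt
      (s := Set.Ioo 0 1)
    convert! this using 1
    simp
  have hinj : Set.InjOn (fun t : ℝ => t / (1 - t)) (Set.Ioo 0 1) := by
    intro s hs t ht h
    have hs' : 1 - s ≠ 0 := by linarith [hs.2]
    have ht' : 1 - t ≠ 0 := by linarith [ht.2]
    simp only at h
    rw [div_eq_div_iff hs' ht'] at h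
    linarith
  rw [← him, integral_image_eq_integral_abs_deriv_smul measurableSet_Ioo hder hinj,
    ← integral_Ioo_rpow_mul_one_sub_rpow hx hy]
  refine setIntegral_congr_fun measurableSet_Ioo fun t ht => ?_
  have h0 : 0 < t := ht.1
  have h2 : 0 < 1 - t := by linarith [ht.2]
  have h3 : 1 + t / (1 - t) = (1 - t)⁻¹ := by field_simp; ring
  simp only [smul_eq_mul]
  rw [h3, abs_of_pos (by positivity), Real.div_rpow h0.le h2.le, Real.inv_rpow h2.le,
    Real.rpow_neg h2.le, inv_inv, show p - x - 1 = p - (x - 1) - (2 : ℕ) by push_cast; ring,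
    Real.rpow_sub h2 (p - (x - 1)), Real.rpow_sub h2 p, Real.rpow_natCast]
  have h4 := (Real.rpow_pos_of_pos h2 (x - 1)).ne'
  generalize (1 - t) ^ (x - 1) = c at *
  field_simp

/-- Polar coordinates followed by u = r². The variable is the squared norm because q-Gaussian
densities are functions of it. -/
theorem EuclideanSpace.integral_fun_norm_sq {d : ℕ} (hd : 1 ≤ d) (g : ℝ → ℝ) :
    ∫ x : EuclideanSpace ℝ (Fin d), g (‖x‖ ^ 2) =
      Real.pi ^ ((d : ℝ) / 2) / Real.Gamma ((d : ℝ) / 2) *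
        ∫ u in Set.Ioi (0 : ℝ), u ^ ((d : ℝ) / 2 - 1) * g u := by
  have : Nonempty (Fin d) := ⟨⟨0, hd⟩⟩
  have hd0 : (0 : ℝ) < d := by exact_mod_cast hd
  have hG := Real.Gamma_pos_of_pos (half_pos hd0)
  rw [integral_fun_norm_addHaar volume (fun r => g (r ^ 2)),
    ← integral_comp_rpow_Ioi_of_pos (g := fun u => u ^ ((d : ℝ) / 2 - 1) * g u) two_pos]
  have h1 : ∫ r in Set.Ioi (0 : ℝ), (2 * r ^ ((2 : ℝ) - 1)) • ((r ^ (2 : ℝ)) ^ ((d : ℝ) / 2 - 1) *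
      g (r ^ (2 : ℝ))) = 2 * ∫ r in Set.Ioi (0 : ℝ), r ^ (d - 1) • g (r ^ 2) := by
    rw [← integral_const_mul]
    refine setIntegral_congr_fun measurableSet_Ioi fun r hr => ?_
    have hr : 0 < r := hr
    simp only [smul_eq_mul]
    rw [← Real.rpow_mul hr.le, Real.rpow_two, ← Real.rpow_natCast r (d - 1), Nat.cast_sub hd,
      mul_assoc, ← mul_assoc (r ^ _) (r ^ _), ← Real.rpow_add hr]
    rw [show (2 : ℝ) - 1 + 2 * ((d : ℝ) / 2 - 1) = d - ((1 : ℕ) : ℝ) by push_cast; ring]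
  rw [h1]
  simp only [finrank_euclideanSpace, Fintype.card_fin, measureReal_def,
    EuclideanSpace.volume_ball, ENNReal.ofReal_one, one_pow, one_mul]
  rw [ENNReal.toReal_ofReal (by have := Real.Gamma_pos_of_pos (show 0 < (d : ℝ) / 2 + 1 by positivity); positivity),
    Real.Gamma_add_one (by positivity), Real.sqrt_eq_rpow, ← Real.rpow_mul_natCast Real.pi_pos.le]
  rw [nsmul_eq_mul, smul_eq_mul]
  rw [show 1 / 2 * (d : ℝ) = d / 2 by ring]
  field_simp

theorem integral_Ioi_rpow_mul_comp_mul {a : ℝ} (ha : 0 < a) (x : ℝ) (g : ℝ → ℝ) :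
    ∫ u in Set.Ioi (0 : ℝ), u ^ (x - 1) * g (a * u) =
      a ^ (-x) * ∫ u in Set.Ioi (0 : ℝ), u ^ (x - 1) * g u := by
  have h := integral_comp_mul_left_Ioi (fun u => u ^ (x - 1) * g u) 0 ha
  rw [mul_zero] at h
  have h2 : ∫ u in Set.Ioi (0 : ℝ), (a * u) ^ (x - 1) * g (a * u) =
      a ^ (x - 1) * ∫ u in Set.Ioi (0 : ℝ), u ^ (x - 1) * g (a * u) := by
    rw [← integral_const_mul]
    refine setIntegral_congr_fun measurableSet_Ioi fun u hu => ?_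
    rw [Real.mul_rpow ha.le (Set.mem_Ioi.1 hu).le, mul_assoc]
  rw [h2, smul_eq_mul] at h
  have h3 : a ^ (x - 1) ≠ 0 := (Real.rpow_pos_of_pos ha _).ne'
  rw [← mul_right_inj' h3, h, ← mul_assoc, ← Real.rpow_add ha]
  congr 1
  rw [show x - 1 + -x = -1 by ring, Real.rpow_neg_one]

/-! ### Normalization and second moment of the standard q-Gaussian density. -/

theorem qC1_denom_pos {q : ℝ} {d : ℕ} (hq : q < ((d : ℝ) + 4) / ((d : ℝ) + 2)) :
    0 < 2 + ((d : ℝ) + 2) * (1 - q) := by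
  rw [lt_div_iff₀ (by positivity)] at hq
  linarith

theorem qC1_pos {q : ℝ} {d : ℕ} (hq : q < ((d : ℝ) + 4) / ((d : ℝ) + 2)) : 0 < qC1 q d :=
  div_pos two_pos (qC1_denom_pos hq)

theorem qC1_one (d : ℕ) : qC1 1 d = 1 := by simp [qC1]

/-- For q > 1 the density has a power tail, and this inequality is exactly the finiteness of its
second moment. -/
theorem dim_half_lt_one_div {q : ℝ} {d : ℕ} (hq : q < ((d : ℝ) + 4) / ((d : ℝ) + 2))
    (hq1 : 1 < q) : (d : ℝ) / 2 + 1 < 1 / (q - 1) := by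
  rw [lt_div_iff₀ (by linarith)]
  nlinarith [qC1_denom_pos hq]

theorem lt_two_of_lt {q : ℝ} {d : ℕ} (hq : q < ((d : ℝ) + 4) / ((d : ℝ) + 2)) : q < 2 ∨ d = 0 := by
  rcases Nat.eq_zero_or_pos d with h | h
  · exact Or.inr h
  · left
    have := qC1_denom_pos hq
    have h1 : (1 : ℝ) ≤ d := by exact_mod_cast h
    by_contra! h2
    nlinarith

theorem qC0_pos {q : ℝ} {d : ℕ} (hq : q < ((d : ℝ) + 4) / ((d : ℝ) + 2)) : 0 < qC0 q d := by
  have h1 := qC1_pos hq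
  have hpi := Real.pi_pos
  unfold qC0
  split_ifs with h h'
  · have h2 : 0 < 1 - q := by linarith
    have h3 : 0 < (2 - q) / (1 - q) := div_pos (by linarith) h2
    have := Real.Gamma_pos_of_pos h3
    have := Real.Gamma_pos_of_pos (show 0 < (2 - q) / (1 - q) + (d : ℝ) / 2 by positivity)
    positivity
  · have h2 : 0 < q - 1 := by linarith
    have h3 := dim_half_lt_one_div hq h'
    have := Real.Gamma_pos_of_pos (show 0 < 1 / (q - 1) by positivity)
    have := Real.Gamma_pos_of_pos (show 0 < 1 / (q - 1) - (d : ℝ) / 2 by linarith)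
    positivity
  · positivity

theorem integral_Ioi_rpow_mul_qExp_of_lt_one {q c x : ℝ} (hq : q < 1) (hc : 0 < c) (hx : 0 < x) :
    ∫ u in Set.Ioi (0 : ℝ), u ^ (x - 1) * qExp q (-(1 / 2) * c * u) =
      ((1 - q) * c / 2) ^ (-x) * beta x ((2 - q) / (1 - q)) := by
  have h1 : 0 < 1 - q := by linarith
  rw [show (2 - q) / (1 - q) = 1 / (1 - q) + 1 by field_simp; ring,
    ← integral_Ioi_rpow_mul_max_one_sub_rpow hx (by positivity),
    ← integral_Ioi_rpow_mul_comp_mul (by positivity) x (fun u => (max 0 (1 - u)) ^ (1 / (1 - q)))]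
  congr 1
  ext u
  rw [qExp, if_neg hq.ne, show 1 + (1 - q) * (-(1 / 2) * c * u) = 1 - (1 - q) * c / 2 * u by ring]

theorem integral_Ioi_rpow_mul_qExp_of_one_lt {q c x : ℝ} (hq : 1 < q) (hc : 0 < c) (hx : 0 < x)
    (hxq : x < 1 / (q - 1)) :
    ∫ u in Set.Ioi (0 : ℝ), u ^ (x - 1) * qExp q (-(1 / 2) * c * u) =
      ((q - 1) * c / 2) ^ (-x) * beta x (1 / (q - 1) - x) := by
  have h1 : 0 < q - 1 := by linarith
  rw [← integral_Ioi_rpow_mul_one_add_rpow_neg hx hxq,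
    ← integral_Ioi_rpow_mul_comp_mul (by positivity) x (fun u => (1 + u) ^ (-(1 / (q - 1))))]
  refine setIntegral_congr_fun measurableSet_Ioi fun u hu => ?_
  have hu : 0 < u := hu
  rw [qExp, if_neg hq.ne', show 1 + (1 - q) * (-(1 / 2) * c * u) = 1 + (q - 1) * c / 2 * u by ring,
    max_eq_right (by positivity), ← one_div_neg_eq_neg_one_div, neg_sub]

theorem integral_Ioi_rpow_mul_qExp_one {x : ℝ} (hx : 0 < x) :
    ∫ u in Set.Ioi (0 : ℝ), u ^ (x - 1) * qExp 1 (-(1 / 2) * 1 * u) = 2 ^ x * Real.Gamma x := by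
  have h := Real.integral_rpow_mul_exp_neg_mul_Ioi hx one_half_pos
  rw [one_div_one_div] at h
  rw [← h]
  congr 1
  ext u
  rw [qExp, if_pos rfl]
  congr 2
  ring

/-- In each of the three regimes of q the radial integral is a Beta or Gamma value; the factor
Γ(d/2) cancels against the one from polar coordinates, and `qC0` is the reciprocal of what is left.
-/
theorem integral_qC0_mul_qExp {q : ℝ} {d : ℕ} (hd : 1 ≤ d)
    (hq : q < ((d : ℝ) + 4) / ((d : ℝ) + 2)) :
    ∫ z : EuclideanSpace ℝ (Fin d), qC0 q d * qExp q (-(1 / 2) * qC1 q d * ‖z‖ ^ 2) = 1 := by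
  have hd0 : (0 : ℝ) < d / 2 := by have : (0 : ℝ) < d := by exact_mod_cast hd
                                   positivity
  have hc := qC1_pos hq
  have hpi := Real.pi_pos
  have hG := (Real.Gamma_pos_of_pos hd0).ne'
  rw [integral_const_mul,
    EuclideanSpace.integral_fun_norm_sq hd (fun u => qExp q (-(1 / 2) * qC1 q d * u))]
  rcases lt_trichotomy q 1 with h | h | h
  · have h2 : 0 < 1 - q := by linarith
    have h3 : 0 < (2 - q) / (1 - q) := div_pos (by linarith) h2
    have h4 := (Real.Gamma_pos_of_pos h3).ne'
    have h5 := (Real.Gamma_pos_of_pos (add_pos h3 hd0)).ne'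
    rw [integral_Ioi_rpow_mul_qExp_of_lt_one h hc hd0, qC0, if_pos h, beta,
      show (1 - q) * qC1 q d / (2 * Real.pi) = (1 - q) * qC1 q d / 2 / Real.pi by field_simp,
      Real.div_rpow (by positivity) hpi.le, Real.rpow_neg (by positivity),
      add_comm ((d : ℝ) / 2) ((2 - q) / (1 - q))]
    have h6 := (Real.rpow_pos_of_pos hpi ((d : ℝ) / 2)).ne'
    have h7 := (Real.rpow_pos_of_pos (show 0 < (1 - q) * qC1 q d / 2 by positivity)
      ((d : ℝ) / 2)).ne'
    generalize (2 - q) / (1 - q) = p at *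
    generalize ((1 - q) * qC1 q d / 2) ^ ((d : ℝ) / 2) = y at *
    field_simp
  · subst h
    rw [qC1_one, integral_Ioi_rpow_mul_qExp_one hd0, qC0, if_neg (lt_irrefl _),
      if_neg (lt_irrefl _), one_div, Real.inv_rpow (by positivity),
      Real.mul_rpow (by positivity) hpi.le]
    have h6 := (Real.rpow_pos_of_pos hpi ((d : ℝ) / 2)).ne'
    have h7 := (Real.rpow_pos_of_pos (two_pos (α := ℝ)) ((d : ℝ) / 2)).ne'
    field_simp
  · have h2 : 0 < q - 1 := by linarith
    have h3 := dim_half_lt_one_div hq h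
    have h4 := (Real.Gamma_pos_of_pos (show 0 < 1 / (q - 1) by positivity)).ne'
    have h5 := (Real.Gamma_pos_of_pos (show 0 < 1 / (q - 1) - (d : ℝ) / 2 by linarith)).ne'
    rw [integral_Ioi_rpow_mul_qExp_of_one_lt h hc hd0 (by linarith), qC0, if_neg h.not_gt,
      if_pos h, beta,
      show (q - 1) * qC1 q d / (2 * Real.pi) = (q - 1) * qC1 q d / 2 / Real.pi by field_simp,
      Real.div_rpow (by positivity) hpi.le, Real.rpow_neg (by positivity),
      add_sub_cancel]
    have h6 := (Real.rpow_pos_of_pos hpi ((d : ℝ) / 2)).ne'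
    have h7 := (Real.rpow_pos_of_pos (show 0 < (q - 1) * qC1 q d / 2 by positivity)
      ((d : ℝ) / 2)).ne'
    generalize 1 / (q - 1) - (d : ℝ) / 2 = r at *
    generalize 1 / (q - 1) = p at *
    generalize ((q - 1) * qC1 q d / 2) ^ ((d : ℝ) / 2) = y at *
    field_simp

/-- Raising the exponent by one multiplies the Beta or Gamma value by an elementary factor, through
Γ(x+1) = xΓ(x). The constant `qC1` is what makes this factor equal to d, so that the covariance is
the identity. -/
theorem integral_Ioi_rpow_half_dim_mul_qExp {q : ℝ} {d : ℕ} (hd : 1 ≤ d)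
    (hq : q < ((d : ℝ) + 4) / ((d : ℝ) + 2)) :
    ∫ u in Set.Ioi (0 : ℝ), u ^ ((d : ℝ) / 2 + 1 - 1) * qExp q (-(1 / 2) * qC1 q d * u) =
      d * ∫ u in Set.Ioi (0 : ℝ), u ^ ((d : ℝ) / 2 - 1) * qExp q (-(1 / 2) * qC1 q d * u) := by
  have hd0 : (0 : ℝ) < d / 2 := by have : (0 : ℝ) < d := by exact_mod_cast hd
                                   positivity
  have hc := qC1_pos hq
  have hden := (qC1_denom_pos hq).ne'
  rcases lt_trichotomy q 1 with h | h | h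
  · have h2 : 0 < 1 - q := by linarith
    have h3 : 0 < (2 - q) / (1 - q) := div_pos (by linarith) h2
    have h4 := (Real.Gamma_pos_of_pos h3).ne'
    have h5 := (Real.Gamma_pos_of_pos (add_pos hd0 h3)).ne'
    have ha : 0 < (1 - q) * qC1 q d / 2 := by positivity
    -- With a = (1-q)C₁/2 and p = (2-q)/(1-q), the ratio of the two integrals is (d/2)/(a(d/2+p));
    -- this identity makes it d.
    have h8 : 2 * ((1 - q) * qC1 q d / 2) * (d / 2 + (2 - q) / (1 - q)) = 1 := by
      rw [qC1]; field_simp; ring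
    rw [integral_Ioi_rpow_mul_qExp_of_lt_one h hc hd0,
      integral_Ioi_rpow_mul_qExp_of_lt_one h hc (by positivity), beta, beta,
      show (d : ℝ) / 2 + 1 + (2 - q) / (1 - q) = d / 2 + (2 - q) / (1 - q) + 1 by ring,
      Real.Gamma_add_one hd0.ne', Real.Gamma_add_one (by positivity),
      neg_add, Real.rpow_add ha, Real.rpow_neg_one]
    generalize ((1 - q) * qC1 q d / 2) = a at *
    generalize a ^ (-((d : ℝ) / 2)) = y at *
    have h9 := (add_pos hd0 h3).ne'
    generalize (d : ℝ) / 2 + (2 - q) / (1 - q) = p at *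
    field_simp
    linear_combination -y * h8
  · subst h
    rw [qC1_one, integral_Ioi_rpow_mul_qExp_one hd0, integral_Ioi_rpow_mul_qExp_one (by positivity),
      Real.Gamma_add_one hd0.ne', Real.rpow_add two_pos, Real.rpow_one]
    ring
  · have h2 : 0 < q - 1 := by linarith
    have h3 := dim_half_lt_one_div hq h
    have h4 := (Real.Gamma_pos_of_pos (show 0 < 1 / (q - 1) by positivity)).ne'
    have h5 : 0 < 1 / (q - 1) - ((d : ℝ) / 2 + 1) := by linarith
    have ha : 0 < (q - 1) * qC1 q d / 2 := by positivity
    have h8 : 2 * ((q - 1) * qC1 q d / 2) * (1 / (q - 1) - ((d : ℝ) / 2 + 1)) = 1 := by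
      rw [qC1]; field_simp; ring
    rw [integral_Ioi_rpow_mul_qExp_of_one_lt h hc hd0 (by linarith),
      integral_Ioi_rpow_mul_qExp_of_one_lt h hc (by positivity) (by linarith), beta, beta,
      add_sub_cancel, add_sub_cancel,
      show 1 / (q - 1) - (d : ℝ) / 2 = 1 / (q - 1) - ((d : ℝ) / 2 + 1) + 1 by ring,
      Real.Gamma_add_one hd0.ne', Real.Gamma_add_one h5.ne',
      neg_add, Real.rpow_add ha, Real.rpow_neg_one]
    generalize ((q - 1) * qC1 q d / 2) = a at *
    generalize a ^ (-((d : ℝ) / 2)) = y at *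
    generalize 1 / (q - 1) - ((d : ℝ) / 2 + 1) = p at *
    field_simp
    linear_combination -y * h8

theorem integral_norm_sq_mul_qC0_mul_qExp {q : ℝ} {d : ℕ} (hd : 1 ≤ d)
    (hq : q < ((d : ℝ) + 4) / ((d : ℝ) + 2)) :
    ∫ z : EuclideanSpace ℝ (Fin d),
      ‖z‖ ^ 2 * (qC0 q d * qExp q (-(1 / 2) * qC1 q d * ‖z‖ ^ 2)) = d := by
  have h := integral_qC0_mul_qExp hd hq
  rw [integral_const_mul,
    EuclideanSpace.integral_fun_norm_sq hd (fun u => qExp q (-(1 / 2) * qC1 q d * u))] at h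
  simp_rw [mul_left_comm _ (qC0 q d)]
  rw [integral_const_mul,
    EuclideanSpace.integral_fun_norm_sq hd (fun u => u * qExp q (-(1 / 2) * qC1 q d * u))]
  have h1 : ∫ u in Set.Ioi (0 : ℝ), u ^ ((d : ℝ) / 2 - 1) *
      (u * qExp q (-(1 / 2) * qC1 q d * u)) =
      ∫ u in Set.Ioi (0 : ℝ), u ^ ((d : ℝ) / 2 + 1 - 1) * qExp q (-(1 / 2) * qC1 q d * u) := by
    refine setIntegral_congr_fun measurableSet_Ioi fun u hu => ?_
    have hu : 0 < u := hu
    rw [← mul_assoc, ← Real.rpow_add_one hu.ne', sub_add_cancel, add_sub_cancel_right]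
  rw [h1, integral_Ioi_rpow_half_dim_mul_qExp hd hq]
  linear_combination (d : ℝ) * h

/-! ### The q-Gaussian density under affine changes of variables. -/

theorem qExp_nonneg (q t : ℝ) : 0 ≤ qExp q t := by
  unfold qExp
  split_ifs
  · positivity
  · exact Real.rpow_nonneg (le_max_left _ _) _

theorem measurable_qExp (q : ℝ) : Measurable (qExp q) := by
  unfold qExp
  split_ifs <;> fun_prop

theorem measurable_qGaussianPDF {d : ℕ} (q : ℝ) (v : EuclideanSpace ℝ (Fin d))
    (V : Matrix (Fin d) (Fin d) ℝ) : Measurable (qGaussianPDF q v V) := by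
  unfold qGaussianPDF
  refine ((measurable_qExp q).comp ?_).const_mul _
  refine (Continuous.measurable ?_).const_mul _
  exact ((PiLp.continuous_ofLp 2 _).comp (continuous_id.sub continuous_const)).dotProduct
    (continuous_const.matrix_mulVec
      ((PiLp.continuous_ofLp 2 _).comp (continuous_id.sub continuous_const)))

theorem qGaussianPDF_nonneg {d : ℕ} {q : ℝ} (hq : q < ((d : ℝ) + 4) / ((d : ℝ) + 2))
    (v x : EuclideanSpace ℝ (Fin d)) {V : Matrix (Fin d) (Fin d) ℝ} (hV : 0 ≤ V.det) :
    0 ≤ qGaussianPDF q v V x :=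
  mul_nonneg (mul_nonneg (qC0_pos hq).le (Real.rpow_nonneg hV _)) (qExp_nonneg _ _)

theorem EuclideanSpace.dotProduct_ofLp_self {d : ℕ} (x : EuclideanSpace ℝ (Fin d)) :
    WithLp.ofLp x ⬝ᵥ WithLp.ofLp x = ‖x‖ ^ 2 := by
  rw [EuclideanSpace.real_norm_sq_eq, dotProduct]
  simp only [sq]

theorem qGaussianPDF_zero_one {d : ℕ} (q : ℝ) (x : EuclideanSpace ℝ (Fin d)) :
    qGaussianPDF q 0 1 x = qC0 q d * qExp q (-(1 / 2) * qC1 q d * ‖x‖ ^ 2) := by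
  simp [qGaussianPDF, EuclideanSpace.dotProduct_ofLp_self]

/-- The affine map `z ↦ v + B z` of Euclidean space. -/
noncomputable def affineMatrixMap {d : ℕ} (v : EuclideanSpace ℝ (Fin d)) (B : Matrix (Fin d) (Fin d) ℝ)
    (z : EuclideanSpace ℝ (Fin d)) : EuclideanSpace ℝ (Fin d) :=
  v + Matrix.toEuclideanLin B z

theorem continuous_affineMatrixMap {d : ℕ} (v : EuclideanSpace ℝ (Fin d))
    (B : Matrix (Fin d) (Fin d) ℝ) : Continuous (affineMatrixMap v B) :=
  continuous_const.add (LinearMap.continuous_of_finiteDimensional _)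

theorem measurable_affineMatrixMap {d : ℕ} (v : EuclideanSpace ℝ (Fin d))
    (B : Matrix (Fin d) (Fin d) ℝ) : Measurable (affineMatrixMap v B) :=
  (continuous_affineMatrixMap v B).measurable

theorem ofLp_affineMatrixMap {d : ℕ} (v : EuclideanSpace ℝ (Fin d))
    (B : Matrix (Fin d) (Fin d) ℝ) (z : EuclideanSpace ℝ (Fin d)) :
    WithLp.ofLp (affineMatrixMap v B z) = WithLp.ofLp v + B *ᵥ WithLp.ofLp z := by
  simp [affineMatrixMap]

theorem Matrix.det_toEuclideanLin {d : ℕ} (B : Matrix (Fin d) (Fin d) ℝ) :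
    LinearMap.det (Matrix.toEuclideanLin B) = B.det := by
  rw [Matrix.toEuclideanLin, Matrix.toLpLin_eq_toLin, LinearMap.det_toLin]

theorem lintegral_comp_affineMatrixMap {d : ℕ} (v : EuclideanSpace ℝ (Fin d))
    {B : Matrix (Fin d) (Fin d) ℝ} (hB : B.det ≠ 0) {h : EuclideanSpace ℝ (Fin d) → ℝ≥0∞}
    (hh : Measurable h) :
    ∫⁻ x, h x = ENNReal.ofReal |B.det| * ∫⁻ z, h (affineMatrixMap v B z) := by
  have hL : LinearMap.det (Matrix.toEuclideanLin B) ≠ 0 := by rwa [Matrix.det_toEuclideanLin]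
  have h1 := Measure.map_linearMap_addHaar_eq_smul_addHaar
    (volume : Measure (EuclideanSpace ℝ (Fin d))) hL
  have h2 : ∫⁻ z, h (affineMatrixMap v B z) =
      ENNReal.ofReal |B.det⁻¹| * ∫⁻ x, h (v + x) := by
    have := lintegral_map (μ := volume) (f := fun x => h (v + x)) (g := Matrix.toEuclideanLin B)
      (by fun_prop) (LinearMap.continuous_of_finiteDimensional _).measurable
    rw [h1, Matrix.det_toEuclideanLin, lintegral_smul_measure, smul_eq_mul] at this
    exact this.symm
  rw [h2, lintegral_add_left_eq_self, ← mul_assoc, ← ENNReal.ofReal_mul (abs_nonneg _),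
    ← abs_mul, mul_inv_cancel₀ hB, abs_one, ENNReal.ofReal_one, one_mul]

theorem abs_det_mul_qGaussianPDF_affineMatrixMap {d : ℕ} (q : ℝ) (v : EuclideanSpace ℝ (Fin d))
    {B : Matrix (Fin d) (Fin d) ℝ} (hB : B.det ≠ 0) (z : EuclideanSpace ℝ (Fin d)) :
    |B.det| * qGaussianPDF q v (B * Bᵀ) (affineMatrixMap v B z) = qGaussianPDF q 0 1 z := by
  have hu : IsUnit B.det := hB.isUnit
  have h1 : (B * Bᵀ).det ^ (-(1 / 2) : ℝ) = |B.det|⁻¹ := by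
    rw [det_mul, det_transpose, ← abs_mul_abs_self, ← sq, ← Real.rpow_natCast,
      ← Real.rpow_mul (abs_nonneg _), ← Real.rpow_neg_one]
    norm_num
  have h2 : WithLp.ofLp (affineMatrixMap v B z - v) = B *ᵥ WithLp.ofLp z := by
    rw [WithLp.ofLp_sub, ofLp_affineMatrixMap, add_sub_cancel_left]
  have h3 : (B *ᵥ WithLp.ofLp z) ⬝ᵥ ((B * Bᵀ)⁻¹ *ᵥ (B *ᵥ WithLp.ofLp z)) = ‖z‖ ^ 2 := by
    have hut : IsUnit Bᵀ.det := by rwa [det_transpose]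
    rw [Matrix.mul_inv_rev, mulVec_mulVec, mul_assoc, nonsing_inv_mul _ hu, mul_one,
      dotProduct_comm, dotProduct_mulVec, ← mulVec_transpose, mulVec_mulVec,
      mul_nonsing_inv _ hut, one_mulVec, EuclideanSpace.dotProduct_ofLp_self]
  rw [qGaussianPDF, h1, h2, h3, qGaussianPDF_zero_one]
  have : |B.det| ≠ 0 := abs_ne_zero.2 hB
  field_simp

/-- This reduces every integral against a q-Gaussian to the standard one. For orthogonal B and v = 0
it also expresses the rotation invariance of the standard law. -/
theorem map_affineMatrixMap_qGaussian {d : ℕ} (q : ℝ) (v : EuclideanSpace ℝ (Fin d))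
    {B : Matrix (Fin d) (Fin d) ℝ} (hB : B.det ≠ 0) :
    (qGaussian q 0 1).map (affineMatrixMap v B) = qGaussian q v (B * Bᵀ) := by
  ext s hs
  have hm := measurable_affineMatrixMap v B
  rw [Measure.map_apply hm hs, qGaussian, qGaussian, withDensity_apply _ (hm hs),
    withDensity_apply _ hs, ← lintegral_indicator (hm hs), ← lintegral_indicator hs,
    lintegral_comp_affineMatrixMap v hB
      ((measurable_qGaussianPDF q v _).ennreal_ofReal.indicator hs),
    ← lintegral_const_mul' _ _ ENNReal.ofReal_ne_top]
  congr 1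
  ext z
  by_cases hz : affineMatrixMap v B z ∈ s
  · rw [Set.indicator_of_mem hz, Set.indicator_of_mem (show z ∈ _ from hz),
      ← ENNReal.ofReal_mul (abs_nonneg _), abs_det_mul_qGaussianPDF_affineMatrixMap q v hB]
  · rw [Set.indicator_of_notMem hz, Set.indicator_of_notMem (show z ∉ _ from hz), mul_zero]

/-! ### First and second moments of the standard q-Gaussian. -/

section Moments

variable {d : ℕ} {q : ℝ}

theorem integrable_qGaussian_iff (hq : q < ((d : ℝ) + 4) / ((d : ℝ) + 2))
    (v : EuclideanSpace ℝ (Fin d)) {V : Matrix (Fin d) (Fin d) ℝ} (hV : 0 ≤ V.det)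
    {g : EuclideanSpace ℝ (Fin d) → ℝ} :
    Integrable g (qGaussian q v V) ↔ Integrable (fun x => g x * qGaussianPDF q v V x) volume := by
  rw [qGaussian, integrable_withDensity_iff (measurable_qGaussianPDF q v V).ennreal_ofReal
    (Filter.Eventually.of_forall fun x => ENNReal.ofReal_lt_top)]
  simp only [ENNReal.toReal_ofReal (qGaussianPDF_nonneg hq v _ hV)]

theorem integral_qGaussian (hq : q < ((d : ℝ) + 4) / ((d : ℝ) + 2))
    (v : EuclideanSpace ℝ (Fin d)) {V : Matrix (Fin d) (Fin d) ℝ} (hV : 0 ≤ V.det)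
    (g : EuclideanSpace ℝ (Fin d) → ℝ) :
    ∫ x, g x ∂(qGaussian q v V) = ∫ x, g x * qGaussianPDF q v V x := by
  rw [qGaussian, integral_withDensity_eq_integral_toReal_smul
    (measurable_qGaussianPDF q v V).ennreal_ofReal
    (Filter.Eventually.of_forall fun x => ENNReal.ofReal_lt_top)]
  simp only [ENNReal.toReal_ofReal (qGaussianPDF_nonneg hq v _ hV), smul_eq_mul, mul_comm]

theorem isProbabilityMeasure_qGaussian_zero_one (hd : 1 ≤ d)
    (hq : q < ((d : ℝ) + 4) / ((d : ℝ) + 2)) :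
    IsProbabilityMeasure (qGaussian q (0 : EuclideanSpace ℝ (Fin d)) 1) := by
  have h := integral_qC0_mul_qExp hd hq
  simp_rw [← qGaussianPDF_zero_one] at h
  constructor
  have hi : Integrable (qGaussianPDF q (0 : EuclideanSpace ℝ (Fin d)) 1) volume :=
    -- The Bochner integral of a non-integrable function is 0 by convention, so a nonzero value
    -- certifies integrability.
    Integrable.of_integral_ne_zero (by rw [h]; exact one_ne_zero)
  rw [qGaussian, withDensity_apply _ MeasurableSet.univ, setLIntegral_univ,
    ← ofReal_integral_eq_lintegral_ofReal hi
      (Filter.Eventually.of_forall fun x => qGaussianPDF_nonneg hq 0 x (by simp)), h,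
    ENNReal.ofReal_one]

theorem integral_norm_sq_qGaussian_zero_one (hd : 1 ≤ d)
    (hq : q < ((d : ℝ) + 4) / ((d : ℝ) + 2)) :
    ∫ z, ‖z‖ ^ 2 ∂(qGaussian q (0 : EuclideanSpace ℝ (Fin d)) 1) = d := by
  rw [integral_qGaussian hq 0 (by simp)]
  simp_rw [qGaussianPDF_zero_one]
  exact integral_norm_sq_mul_qC0_mul_qExp hd hq

theorem integrable_norm_sq_qGaussian_zero_one (hd : 1 ≤ d)
    (hq : q < ((d : ℝ) + 4) / ((d : ℝ) + 2)) :
    Integrable (fun z => ‖z‖ ^ 2) (qGaussian q (0 : EuclideanSpace ℝ (Fin d)) 1) := by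
  refine Integrable.of_integral_ne_zero ?_
  rw [integral_norm_sq_qGaussian_zero_one hd hq]
  exact_mod_cast (by omega : d ≠ 0)

theorem integrable_coord_mul_coord_qGaussian_zero_one (hd : 1 ≤ d)
    (hq : q < ((d : ℝ) + 4) / ((d : ℝ) + 2)) (i j : Fin d) :
    Integrable (fun z => z i * z j) (qGaussian q (0 : EuclideanSpace ℝ (Fin d)) 1) := by
  refine (integrable_norm_sq_qGaussian_zero_one hd hq).mono' (by fun_prop)
    (Filter.Eventually.of_forall fun z => ?_)
  rw [norm_mul, sq]
  exact mul_le_mul (PiLp.norm_apply_le z i) (PiLp.norm_apply_le z j) (norm_nonneg _) (norm_nonneg _)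

theorem integrable_coord_qGaussian_zero_one (hd : 1 ≤ d)
    (hq : q < ((d : ℝ) + 4) / ((d : ℝ) + 2)) (i : Fin d) :
    Integrable (fun z => z i) (qGaussian q (0 : EuclideanSpace ℝ (Fin d)) 1) := by
  have := isProbabilityMeasure_qGaussian_zero_one hd hq
  have h : MemLp (fun z => z i) 2 (qGaussian q (0 : EuclideanSpace ℝ (Fin d)) 1) := by
    rw [memLp_two_iff_integrable_sq (by fun_prop)]
    simpa [sq] using integrable_coord_mul_coord_qGaussian_zero_one hd hq i i
  exact h.integrable (by norm_num)

theorem integral_comp_orthogonal_qGaussian_zero_one (q : ℝ) {U : Matrix (Fin d) (Fin d) ℝ}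
    (hU : U * Uᵀ = 1) {g : EuclideanSpace ℝ (Fin d) → ℝ} (hg : Continuous g) :
    ∫ z, g (affineMatrixMap 0 U z) ∂(qGaussian q 0 1) = ∫ z, g z ∂(qGaussian q 0 1) := by
  have hdet : U.det ≠ 0 := by
    intro h
    have := congrArg Matrix.det hU
    simp [h] at this
  have h := map_affineMatrixMap_qGaussian q 0 hdet
  rw [hU] at h
  conv_rhs => rw [← h]
  rw [integral_map (measurable_affineMatrixMap 0 U).aemeasurable hg.aestronglyMeasurable]

/-- The diagonal matrix of the reflection in the `i`-th coordinate. -/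
def coordReflection (i : Fin d) : Matrix (Fin d) (Fin d) ℝ :=
  diagonal fun k => if k = i then -1 else 1

theorem coordReflection_mul_transpose (i : Fin d) :
    coordReflection i * (coordReflection i)ᵀ = 1 := by
  rw [coordReflection, diagonal_transpose, diagonal_mul_diagonal, ← diagonal_one]
  congr 1
  ext k
  split_ifs <;> norm_num

theorem affineMatrixMap_coordReflection_apply (i k : Fin d) (z : EuclideanSpace ℝ (Fin d)) :
    affineMatrixMap 0 (coordReflection i) z k = if k = i then -z k else z k := by
  rw [ofLp_affineMatrixMap, coordReflection]
  simp [mulVec_diagonal]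

theorem integral_coord_qGaussian_zero_one (q : ℝ) (i : Fin d) :
    ∫ z, z i ∂(qGaussian q (0 : EuclideanSpace ℝ (Fin d)) 1) = 0 := by
  have h := integral_comp_orthogonal_qGaussian_zero_one q (coordReflection_mul_transpose i)
    (g := fun z => z i) (by fun_prop)
  simp only [affineMatrixMap_coordReflection_apply, if_true, integral_neg] at h
  linarith

/-- By orthogonal invariance: transpositions make the diagonal moments equal, and their sum is E|z|²
= d; a coordinate reflection changes the sign of each off-diagonal moment. -/
theorem integral_coord_mul_coord_qGaussian_zero_one (hd : 1 ≤ d)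
    (hq : q < ((d : ℝ) + 4) / ((d : ℝ) + 2)) (i j : Fin d) :
    ∫ z, z i * z j ∂(qGaussian q (0 : EuclideanSpace ℝ (Fin d)) 1) =
      (1 : Matrix (Fin d) (Fin d) ℝ) i j := by
  by_cases hij : i = j
  · subst hij
    have hk : ∀ k : Fin d, ∫ z, z k * z k ∂(qGaussian q (0 : EuclideanSpace ℝ (Fin d)) 1) =
        ∫ z, z i * z i ∂(qGaussian q (0 : EuclideanSpace ℝ (Fin d)) 1) := by
      intro k
      have hU : (Equiv.swap i k).permMatrix ℝ * ((Equiv.swap i k).permMatrix ℝ)ᵀ = 1 := by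
        rw [transpose_permMatrix]
        simp [← permMatrix_mul]
      have h := integral_comp_orthogonal_qGaussian_zero_one q hU
        (g := fun z => z i * z i) (by fun_prop)
      rw [← h]
      congr 1
      ext z
      rw [ofLp_affineMatrixMap]
      simp [permMatrix_mulVec]
    have hs := integral_norm_sq_qGaussian_zero_one hd hq
    simp_rw [EuclideanSpace.real_norm_sq_eq, sq] at hs
    rw [integral_finsetSum _ fun k _ => integrable_coord_mul_coord_qGaussian_zero_one hd hq k k,
      Finset.sum_congr rfl fun k _ => hk k] at hs
    have hd0 : (d : ℝ) ≠ 0 := by exact_mod_cast (by omega : d ≠ 0)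
    simp only [Finset.sum_const, Finset.card_univ, Fintype.card_fin, nsmul_eq_mul] at hs
    rw [one_apply_eq]
    exact mul_left_cancel₀ hd0 (by rw [hs, mul_one])
  · have h := integral_comp_orthogonal_qGaussian_zero_one q (coordReflection_mul_transpose i)
      (g := fun z => z i * z j) (by fun_prop)
    simp only [affineMatrixMap_coordReflection_apply, if_true, if_neg (Ne.symm hij), neg_mul,
      integral_neg] at h
    rw [one_apply_ne hij]
    linarith

theorem dotProduct_mulVec_eq_sum (M : Matrix (Fin d) (Fin d) ℝ) (x y : Fin d → ℝ) :
    x ⬝ᵥ (M *ᵥ y) = ∑ i, ∑ j, M i j * (x i * y j) := by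
  simp only [dotProduct, mulVec, Finset.mul_sum]
  exact Finset.sum_congr rfl fun i _ => Finset.sum_congr rfl fun j _ => by ring

theorem integrable_quadratic_qGaussian_zero_one (hd : 1 ≤ d)
    (hq : q < ((d : ℝ) + 4) / ((d : ℝ) + 2)) (M : Matrix (Fin d) (Fin d) ℝ) :
    Integrable (fun z => WithLp.ofLp z ⬝ᵥ (M *ᵥ WithLp.ofLp z))
      (qGaussian q (0 : EuclideanSpace ℝ (Fin d)) 1) := by
  simp_rw [dotProduct_mulVec_eq_sum]
  exact integrable_finsetSum _ fun i _ => integrable_finsetSum _ fun j _ =>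
    (integrable_coord_mul_coord_qGaussian_zero_one hd hq i j).const_mul _

theorem integral_quadratic_qGaussian_zero_one (hd : 1 ≤ d)
    (hq : q < ((d : ℝ) + 4) / ((d : ℝ) + 2)) (M : Matrix (Fin d) (Fin d) ℝ) :
    ∫ z, WithLp.ofLp z ⬝ᵥ (M *ᵥ WithLp.ofLp z)
      ∂(qGaussian q (0 : EuclideanSpace ℝ (Fin d)) 1) = M.trace := by
  have hI := integrable_coord_mul_coord_qGaussian_zero_one hd hq
  simp_rw [dotProduct_mulVec_eq_sum]
  rw [integral_finsetSum]
  · simp_rw [fun i => integral_finsetSum (Finset.univ : Finset (Fin d))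
      fun j (_ : j ∈ Finset.univ) => (hI i j).const_mul (M i j), integral_const_mul,
      integral_coord_mul_coord_qGaussian_zero_one hd hq]
    simp [trace, one_apply]
  · exact fun i _ => integrable_finsetSum _ fun j _ => (hI i j).const_mul _

theorem integrable_linear_qGaussian_zero_one (hd : 1 ≤ d)
    (hq : q < ((d : ℝ) + 4) / ((d : ℝ) + 2)) (u : Fin d → ℝ) :
    Integrable (fun z => u ⬝ᵥ WithLp.ofLp z) (qGaussian q (0 : EuclideanSpace ℝ (Fin d)) 1) :=
  integrable_finsetSum _ fun i _ =>
    (integrable_coord_qGaussian_zero_one hd hq i).const_mul _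

theorem integral_linear_qGaussian_zero_one (hd : 1 ≤ d)
    (hq : q < ((d : ℝ) + 4) / ((d : ℝ) + 2)) (u : Fin d → ℝ) :
    ∫ z, u ⬝ᵥ WithLp.ofLp z ∂(qGaussian q (0 : EuclideanSpace ℝ (Fin d)) 1) = 0 := by
  simp only [dotProduct]
  rw [integral_finsetSum _ fun i _ => (integrable_coord_qGaussian_zero_one hd hq i).const_mul _]
  simp_rw [integral_const_mul, integral_coord_qGaussian_zero_one, mul_zero, Finset.sum_const_zero]

end Moments

/-! ### Moments of general q-Gaussians. -/

section PosDefMoments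

variable {d : ℕ} {q : ℝ} {V : Matrix (Fin d) (Fin d) ℝ}

theorem Matrix.PosDef.transpose_eq_self {V : Matrix (Fin d) (Fin d) ℝ} (hV : V.PosDef) : Vᵀ = V := by
  simpa using hV.isHermitian.eq

theorem Matrix.PosDef.posDef_sqrt (hV : V.PosDef) : (CFC.sqrt V).PosDef := by
  have h0 : (CFC.sqrt V).PosSemidef := (CFC.sqrt_nonneg V).posSemidef
  rw [h0.posDef_iff_det_ne_zero]
  intro h
  have h1 := CFC.sqrt_mul_sqrt_self V hV.posSemidef.nonneg
  have h2 := congrArg Matrix.det h1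
  rw [det_mul, h, zero_mul] at h2
  exact hV.det_pos.ne h2

theorem Matrix.PosDef.exists_mul_transpose_eq (hV : V.PosDef) :
    ∃ B : Matrix (Fin d) (Fin d) ℝ, B.det ≠ 0 ∧ B * Bᵀ = V := by
  refine ⟨CFC.sqrt V, hV.posDef_sqrt.det_pos.ne', ?_⟩
  rw [hV.posDef_sqrt.transpose_eq_self]
  exact CFC.sqrt_mul_sqrt_self V hV.posSemidef.nonneg

theorem isProbabilityMeasure_qGaussian (hd : 1 ≤ d) (hq : q < ((d : ℝ) + 4) / ((d : ℝ) + 2))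
    (v : EuclideanSpace ℝ (Fin d)) (hV : V.PosDef) : IsProbabilityMeasure (qGaussian q v V) := by
  obtain ⟨B, hB, rfl⟩ := hV.exists_mul_transpose_eq
  have := isProbabilityMeasure_qGaussian_zero_one hd hq
  rw [← map_affineMatrixMap_qGaussian q v hB]
  exact Measure.isProbabilityMeasure_map (measurable_affineMatrixMap v B).aemeasurable

theorem integrable_quadratic_qGaussian (hd : 1 ≤ d) (hq : q < ((d : ℝ) + 4) / ((d : ℝ) + 2))
    (v : EuclideanSpace ℝ (Fin d)) (hV : V.PosDef) (S : Matrix (Fin d) (Fin d) ℝ) :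
    Integrable (fun x => WithLp.ofLp (x - v) ⬝ᵥ (S *ᵥ WithLp.ofLp (x - v))) (qGaussian q v V) ∧
    ∫ x, WithLp.ofLp (x - v) ⬝ᵥ (S *ᵥ WithLp.ofLp (x - v)) ∂(qGaussian q v V) =
      (S * V).trace := by
  obtain ⟨B, hB, rfl⟩ := hV.exists_mul_transpose_eq
  have hm := (measurable_affineMatrixMap v B).aemeasurable (μ := qGaussian q 0 1)
  have hc : Continuous fun x : EuclideanSpace ℝ (Fin d) =>
      WithLp.ofLp (x - v) ⬝ᵥ (S *ᵥ WithLp.ofLp (x - v)) :=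
    ((PiLp.continuous_ofLp 2 _).comp (continuous_id.sub continuous_const)).dotProduct
      (continuous_const.matrix_mulVec
        ((PiLp.continuous_ofLp 2 _).comp (continuous_id.sub continuous_const)))
  have h : ∀ z, WithLp.ofLp (affineMatrixMap v B z - v) ⬝ᵥ
      (S *ᵥ WithLp.ofLp (affineMatrixMap v B z - v)) =
      WithLp.ofLp z ⬝ᵥ ((Bᵀ * S * B) *ᵥ WithLp.ofLp z) := by
    intro z
    rw [WithLp.ofLp_sub, ofLp_affineMatrixMap, add_sub_cancel_left, mulVec_mulVec,
      ← vecMul_transpose, ← dotProduct_mulVec, mulVec_mulVec, mul_assoc]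
  rw [← map_affineMatrixMap_qGaussian q v hB, integral_map hm hc.aestronglyMeasurable,
    integrable_map_measure hc.aestronglyMeasurable hm]
  simp only [Function.comp_def, h]
  refine ⟨integrable_quadratic_qGaussian_zero_one hd hq _, ?_⟩
  rw [integral_quadratic_qGaussian_zero_one hd hq, mul_assoc, trace_mul_comm, mul_assoc]

theorem integrable_linear_qGaussian (hd : 1 ≤ d) (hq : q < ((d : ℝ) + 4) / ((d : ℝ) + 2))
    (v : EuclideanSpace ℝ (Fin d)) (hV : V.PosDef) (u : Fin d → ℝ) :
    Integrable (fun x => u ⬝ᵥ WithLp.ofLp (x - v)) (qGaussian q v V) ∧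
    ∫ x, u ⬝ᵥ WithLp.ofLp (x - v) ∂(qGaussian q v V) = 0 := by
  obtain ⟨B, hB, rfl⟩ := hV.exists_mul_transpose_eq
  have hm := (measurable_affineMatrixMap v B).aemeasurable (μ := qGaussian q 0 1)
  have hc : Continuous fun x : EuclideanSpace ℝ (Fin d) => u ⬝ᵥ WithLp.ofLp (x - v) :=
    continuous_const.dotProduct ((PiLp.continuous_ofLp 2 _).comp (continuous_id.sub continuous_const))
  have h : ∀ z, u ⬝ᵥ WithLp.ofLp (affineMatrixMap v B z - v) = (u ᵥ* B) ⬝ᵥ WithLp.ofLp z := by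
    intro z
    rw [WithLp.ofLp_sub, ofLp_affineMatrixMap, add_sub_cancel_left, dotProduct_mulVec]
  rw [← map_affineMatrixMap_qGaussian q v hB, integral_map hm hc.aestronglyMeasurable,
    integrable_map_measure hc.aestronglyMeasurable hm]
  simp only [Function.comp_def, h]
  exact ⟨integrable_linear_qGaussian_zero_one hd hq _, integral_linear_qGaussian_zero_one hd hq _⟩

theorem covariance_coord_qGaussian (hd : 1 ≤ d) (hq : q < ((d : ℝ) + 4) / ((d : ℝ) + 2))
    (hV : V.PosDef) (i j : Fin d) :
    covariance (fun x : EuclideanSpace ℝ (Fin d) => x i)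
      (fun x : EuclideanSpace ℝ (Fin d) => x j) (qGaussian q 0 V) = V i j := by
  have h0 : ∀ k : Fin d, ∫ x : EuclideanSpace ℝ (Fin d), x k ∂(qGaussian q 0 V) = 0 := by
    intro k
    simpa using (integrable_linear_qGaussian hd hq 0 hV (Pi.single k 1)).2
  have h1 := (integrable_quadratic_qGaussian hd hq 0 hV (Matrix.single i j 1)).2
  rw [covariance, h0, h0]
  have h2 : V j i = V i j := congrFun (congrFun hV.transpose_eq_self i) j
  have h3 : ∀ x : Fin d → ℝ, x ⬝ᵥ (Matrix.single i j 1 *ᵥ x) = x i * x j := fun x => by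
    rw [single_mulVec, one_mul, ← Pi.single, dotProduct_single]
  simpa [h3, trace_single_mul, h2] using h1

end PosDefMoments

/-! ### The Wasserstein distance between q-Gaussians. -/

section Wasserstein

variable {d : ℕ}

/-- Passing through the positive part lets a signed dual potential bound an extended-valued
transport cost from below, with no integrability assumption on the cost. -/
theorem ofReal_integral_le_lintegral_ofReal {α : Type*} [MeasurableSpace α] {μ : Measure α}
    {g c : α → ℝ} (hg : Integrable g μ) (hgc : ∀ x, g x ≤ c x) :
    ENNReal.ofReal (∫ x, g x ∂μ) ≤ ∫⁻ x, ENNReal.ofReal (c x) ∂μ :=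
  calc ENNReal.ofReal (∫ x, g x ∂μ) ≤ ENNReal.ofReal (∫ x, max (g x) 0 ∂μ) :=
        ENNReal.ofReal_le_ofReal (integral_mono hg hg.pos_part fun _ => le_max_left _ _)
    _ = ∫⁻ x, ENNReal.ofReal (max (g x) 0) ∂μ :=
        ofReal_integral_eq_lintegral_ofReal hg.pos_part
          (Filter.Eventually.of_forall fun _ => le_max_right _ _)
    _ ≤ ∫⁻ x, ENNReal.ofReal (c x) ∂μ := by
        refine lintegral_mono fun x => ?_
        rw [ENNReal.ofReal_max, ENNReal.ofReal_zero, max_eq_left zero_le]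
        exact ENNReal.ofReal_le_ofReal (hgc x)

/-- Young's inequality for the conjugate quadratic forms of T and T⁻¹, read off from the
nonnegativity of the T⁻¹-form at Tx - y. -/
theorem Matrix.PosDef.two_mul_dotProduct_le {T : Matrix (Fin d) (Fin d) ℝ} (hT : T.PosDef)
    (x y : Fin d → ℝ) : 2 * (x ⬝ᵥ y) ≤ x ⬝ᵥ (T *ᵥ x) + y ⬝ᵥ (T⁻¹ *ᵥ y) := by
  have h := hT.inv.posSemidef.dotProduct_mulVec_nonneg (T *ᵥ x - y)
  have hu : IsUnit T.det := hT.det_pos.ne'.isUnit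
  have h1 : (T *ᵥ x) ⬝ᵥ (T⁻¹ *ᵥ y) = x ⬝ᵥ y := by
    conv_lhs => rw [← hT.transpose_eq_self, mulVec_transpose, ← dotProduct_mulVec, mulVec_mulVec,
      hT.transpose_eq_self, mul_nonsing_inv _ hu, one_mulVec]
  simp only [star_trivial, mulVec_sub, mulVec_mulVec, nonsing_inv_mul _ hu, one_mulVec,
    sub_dotProduct, dotProduct_sub, h1] at h
  rw [dotProduct_comm (T *ᵥ x) x, dotProduct_comm y x] at h
  linarith

theorem map_affine_qGaussian (q : ℝ) (v : EuclideanSpace ℝ (Fin d))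
    {V T : Matrix (Fin d) (Fin d) ℝ} (hV : V.PosDef) (hT : T.det ≠ 0) :
    (qGaussian q v V).map (fun x => affineMatrixMap 0 T (x - v)) = qGaussian q 0 (T * V * Tᵀ) := by
  obtain ⟨B, hB, rfl⟩ := hV.exists_mul_transpose_eq
  have hTB : (T * B).det ≠ 0 := by rw [det_mul]; exact mul_ne_zero hT hB
  have h := map_affineMatrixMap_qGaussian q 0 hTB
  have hm : Measurable fun x => affineMatrixMap 0 T (x - v) :=
    (measurable_affineMatrixMap 0 T).comp (measurable_id.sub_const v)
  rw [← map_affineMatrixMap_qGaussian q v hB, Measure.map_map hm (measurable_affineMatrixMap v B)]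
  rw [show T * (B * Bᵀ) * Tᵀ = T * B * (T * B)ᵀ by rw [transpose_mul]; simp only [mul_assoc], ← h]
  congr 1
  ext z : 1
  apply (WithLp.ofLp_injective 2)
  simp [ofLp_affineMatrixMap]

/-- Kantorovich duality with explicit optimizers. The upper bound uses the coupling carried by the
affine map x ↦ T(x - v). The lower bound uses quadratic potentials, one in each variable, whose sum
is at most the cost by Young's inequality; their integrals depend only on the marginals. -/
theorem wassersteinSq_qGaussian {q : ℝ} (hd : 1 ≤ d) (hq : q < ((d : ℝ) + 4) / ((d : ℝ) + 2))
    (v : EuclideanSpace ℝ (Fin d)) {Y A T : Matrix (Fin d) (Fin d) ℝ} (hY : Y.PosDef)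
    (hA : A.PosDef) (hT : T.PosDef) (hTYA : T * Y * T = A) :
    wassersteinSq (qGaussian q v Y) (qGaussian q 0 A) =
      ENNReal.ofReal (‖v‖ ^ 2 + Y.trace + A.trace - 2 * (T * Y).trace) := by
  have hu : IsUnit T.det := hT.det_pos.ne'.isUnit
  have := isProbabilityMeasure_qGaussian hd hq v hY
  apply le_antisymm
  · have hm : Measurable fun x => affineMatrixMap 0 T (x - v) :=
      (measurable_affineMatrixMap 0 T).comp (measurable_id.sub_const v)
    have hmp : Measurable fun x => (x, affineMatrixMap 0 T (x - v)) := measurable_id.prodMk hm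
    have hmap := map_affine_qGaussian q v hY hT.det_pos.ne'
    rw [hT.transpose_eq_self, hTYA] at hmap
    refine (iInf₂_le ((qGaussian q v Y).map fun x => (x, affineMatrixMap 0 T (x - v)))
      ⟨Measure.isProbabilityMeasure_map hmp.aemeasurable,
        (Measure.map_map measurable_fst hmp).trans Measure.map_id,
        (Measure.map_map measurable_snd hmp).trans hmap⟩).trans (le_of_eq ?_)
    · rw [lintegral_map (by fun_prop) hmp]
      have hcost : ∀ x : EuclideanSpace ℝ (Fin d), ‖x - affineMatrixMap 0 T (x - v)‖ ^ 2 =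
          WithLp.ofLp (x - v) ⬝ᵥ (((1 - T) * (1 - T)) *ᵥ WithLp.ofLp (x - v)) +
            2 * ((WithLp.ofLp v ᵥ* (1 - T)) ⬝ᵥ WithLp.ofLp (x - v)) + ‖v‖ ^ 2 := by
        intro x
        have h1 : WithLp.ofLp (x - affineMatrixMap 0 T (x - v)) =
            (1 - T) *ᵥ WithLp.ofLp (x - v) + WithLp.ofLp v := by
          rw [sub_mulVec, one_mulVec, WithLp.ofLp_sub, ofLp_affineMatrixMap, WithLp.ofLp_sub]
          simp only [WithLp.ofLp_zero, zero_add]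
          abel
        have hsymm : (1 - T)ᵀ = 1 - T := by
          rw [transpose_sub, transpose_one, hT.transpose_eq_self]
        have h2 : ((1 - T) *ᵥ WithLp.ofLp (x - v)) ⬝ᵥ ((1 - T) *ᵥ WithLp.ofLp (x - v)) =
            WithLp.ofLp (x - v) ⬝ᵥ (((1 - T) * (1 - T)) *ᵥ WithLp.ofLp (x - v)) := by
          have h3 : (1 - T) *ᵥ WithLp.ofLp (x - v) = WithLp.ofLp (x - v) ᵥ* (1 - T) := by
            rw [← mulVec_transpose, hsymm]
          nth_rewrite 1 [h3]
          rw [← dotProduct_mulVec, mulVec_mulVec]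
        rw [← EuclideanSpace.dotProduct_ofLp_self, ← EuclideanSpace.dotProduct_ofLp_self, h1,
          add_dotProduct, dotProduct_add, dotProduct_add, h2, ← dotProduct_mulVec,
          dotProduct_comm _ (WithLp.ofLp v)]
        ring
      simp only [hcost]
      obtain ⟨i1, e1⟩ := integrable_quadratic_qGaussian hd hq v hY ((1 - T) * (1 - T))
      obtain ⟨i2, e2⟩ := integrable_linear_qGaussian hd hq v hY (WithLp.ofLp v ᵥ* (1 - T))
      have i3 : Integrable (fun x => WithLp.ofLp (x - v) ⬝ᵥ
          (((1 - T) * (1 - T)) *ᵥ WithLp.ofLp (x - v)) +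
          2 * ((WithLp.ofLp v ᵥ* (1 - T)) ⬝ᵥ WithLp.ofLp (x - v))) (qGaussian q v Y) :=
        i1.add (i2.const_mul 2)
      have i4 : Integrable (fun x => WithLp.ofLp (x - v) ⬝ᵥ
          (((1 - T) * (1 - T)) *ᵥ WithLp.ofLp (x - v)) +
          2 * ((WithLp.ofLp v ᵥ* (1 - T)) ⬝ᵥ WithLp.ofLp (x - v)) + ‖v‖ ^ 2) (qGaussian q v Y) :=
        i3.add (integrable_const _)
      rw [← ofReal_integral_eq_lintegral_ofReal i4
        (Filter.Eventually.of_forall fun x => by simp only [Pi.zero_apply]; rw [← hcost]; positivity)]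
      congr 1
      have h3 : ((1 - T) * (1 - T) * Y).trace = Y.trace + A.trace - 2 * (T * Y).trace := by
        have h4 : (T * T * Y).trace = A.trace := by rw [← hTYA, trace_mul_comm (T * Y), mul_assoc]
        rw [show (1 - T) * (1 - T) * Y = Y - T * Y - T * Y + T * T * Y by noncomm_ring,
          trace_add, trace_sub, trace_sub, h4]
        ring
      rw [integral_add i3 (integrable_const _), integral_add i1 (i2.const_mul 2),
        integral_const_mul, e1, e2, h3]
      simp
      ring
  · refine le_iInf₂ fun π hπ => ?_
    obtain ⟨hπ, h1, h2⟩ := hπ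
    obtain ⟨i1, e1⟩ := integrable_quadratic_qGaussian hd hq v hY (1 - T)
    obtain ⟨i2, e2⟩ := integrable_linear_qGaussian hd hq v hY (WithLp.ofLp v)
    obtain ⟨i3, e3⟩ := integrable_quadratic_qGaussian hd hq 0 hA (1 - T⁻¹)
    obtain ⟨i4, e4⟩ := integrable_linear_qGaussian hd hq 0 hA (WithLp.ofLp v)
    have hI : Integrable (fun x => WithLp.ofLp (x - v) ⬝ᵥ ((1 - T) *ᵥ WithLp.ofLp (x - v)) +
        2 * (WithLp.ofLp v ⬝ᵥ WithLp.ofLp (x - v))) (qGaussian q v Y) := i1.add (i2.const_mul 2)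
    have hJ : Integrable (fun x => WithLp.ofLp (x - 0) ⬝ᵥ ((1 - T⁻¹) *ᵥ WithLp.ofLp (x - 0)) -
        2 * (WithLp.ofLp v ⬝ᵥ WithLp.ofLp (x - 0))) (qGaussian q 0 A) := i3.sub (i4.const_mul 2)
    have eI : ∫ x, (WithLp.ofLp (x - v) ⬝ᵥ ((1 - T) *ᵥ WithLp.ofLp (x - v)) +
        2 * (WithLp.ofLp v ⬝ᵥ WithLp.ofLp (x - v))) ∂(qGaussian q v Y) =
        Y.trace - (T * Y).trace := by
      rw [integral_add i1 (i2.const_mul 2), integral_const_mul, e1, e2, sub_mul, one_mul, trace_sub]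
      ring
    have eJ : ∫ x, (WithLp.ofLp (x - 0) ⬝ᵥ ((1 - T⁻¹) *ᵥ WithLp.ofLp (x - 0)) -
        2 * (WithLp.ofLp v ⬝ᵥ WithLp.ofLp (x - 0))) ∂(qGaussian q 0 A) =
        A.trace - (T * Y).trace := by
      rw [integral_sub i3 (i4.const_mul 2), integral_const_mul, e3, e4, sub_mul, one_mul, trace_sub,
        ← hTYA, mul_assoc T Y T, ← mul_assoc T⁻¹, nonsing_inv_mul _ hu, one_mul, trace_mul_comm Y T]
      ring
    rw [← h1] at hI eI
    rw [← h2] at hJ eJ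
    rw [integral_map measurable_fst.aemeasurable hI.1] at eI
    rw [integral_map measurable_snd.aemeasurable hJ.1] at eJ
    have hI' := hI.comp_measurable measurable_fst
    have hJ' := hJ.comp_measurable measurable_snd
    -- The dual bound: |x - y|² is at least the sum of the two potentials and |v|², for any plan
    -- with the given marginals.
    have hIJ := (hI'.add hJ').add (integrable_const (‖v‖ ^ 2))
    refine le_trans (le_of_eq ?_) (ofReal_integral_le_lintegral_ofReal hIJ fun p => ?_)
    · congr 1
      rw [integral_add' (hI'.add hJ') (integrable_const _), integral_add' hI' hJ']
      simp only [Function.comp_def]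
      rw [eI, eJ]
      simp
      ring
    · have h3 := hT.two_mul_dotProduct_le (WithLp.ofLp (p.1 - v)) (WithLp.ofLp p.2)
      have h4 : WithLp.ofLp (p.1 - p.2) = WithLp.ofLp (p.1 - v) - WithLp.ofLp p.2 + WithLp.ofLp v := by
        simp only [WithLp.ofLp_sub]
        abel
      rw [← EuclideanSpace.dotProduct_ofLp_self (p.1 - p.2), h4]
      simp only [Function.comp_def, Pi.add_apply, sub_zero, sub_mulVec, one_mulVec,
        dotProduct_sub, sub_dotProduct, dotProduct_add, add_dotProduct,
        EuclideanSpace.dotProduct_ofLp_self]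
      rw [dotProduct_comm (WithLp.ofLp p.2) (WithLp.ofLp (p.1 - v)),
        dotProduct_comm (WithLp.ofLp p.2) (WithLp.ofLp v),
        dotProduct_comm (WithLp.ofLp (p.1 - v)) (WithLp.ofLp v)]
      linarith

end Wasserstein

/-! ### The Tsallis entropy of a q-Gaussian. -/

section Entropy

variable {d : ℕ} {q : ℝ}

/-- The Tsallis entropy of a `q`-Gaussian measure, as a function of the determinant of its
covariance matrix. -/
noncomputable def qEntropyOfDet (q : ℝ) (d : ℕ) (t : ℝ) : ℝ :=
  if q = 1 then Real.log (qC0 q d) - d / 2 - 1 / 2 * Real.log t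
  else (qM q d * t ^ ((q - 1) / 2) - 1) / (1 - q)

/-- For `y = k exp_q(-c s / 2)` with `s ≥ 0`, `y ln_q y` is `y` times an affine function of `s`. -/
theorem mul_qLog_qExp {k c s : ℝ} (hk : 0 < k) (hc : 0 < c) (hs : 0 ≤ s) :
    k * qExp q (-(1 / 2) * c * s) * qLog q (k * qExp q (-(1 / 2) * c * s)) =
      (if q = 1 then Real.log k else (k ^ (1 - q) - 1) / (1 - q)) *
        (k * qExp q (-(1 / 2) * c * s)) +
      (if q = 1 then -(1 / 2) * c else k ^ (1 - q) * (-(1 / 2) * c)) *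
        (s * (k * qExp q (-(1 / 2) * c * s))) := by
  by_cases h : q = 1
  · simp only [h, if_true, qLog, qExp]
    rw [Real.log_mul hk.ne' (Real.exp_pos _).ne', Real.log_exp]
    ring
  · simp only [if_neg h, qLog]
    have h1 : 1 - q ≠ 0 := sub_ne_zero.2 (Ne.symm h)
    -- A nonpositive base can occur only for q < 1, outside the interior of the support; there the
    -- density is 0 and both sides vanish whatever the value of `qLog` at 0.
    rcases le_or_gt (1 + (1 - q) * (-(1 / 2) * c * s)) 0 with hb | hb
    · have hq : 0 < 1 - q := by
        by_contra! hq
        have : 0 ≤ (1 - q) * (-(1 / 2) * c * s) :=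
          mul_nonneg_of_nonpos_of_nonpos hq (by nlinarith [mul_nonneg hc.le hs])
        linarith
      have h0 : qExp q (-(1 / 2) * c * s) = 0 := by
        rw [qExp, if_neg h, max_eq_left hb, Real.zero_rpow (by positivity)]
      rw [h0]
      ring
    · have h0 : qExp q (-(1 / 2) * c * s) ^ (1 - q) = 1 + (1 - q) * (-(1 / 2) * c * s) := by
        rw [qExp, if_neg h, max_eq_right hb.le, ← Real.rpow_mul hb.le, one_div_mul_cancel h1,
          Real.rpow_one]
      rw [Real.mul_rpow hk.le (qExp_nonneg _ _), h0]
      field_simp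
      ring

/-- The entropy integrand is almost everywhere the density times an affine function of the form ⟨x -
v, V⁻¹(x - v)⟩, whose mean is tr(V⁻¹V) = d. Thus V enters only through the normalizing factor, that
is, through its determinant. -/
theorem tsallis_qGaussian (hd : 1 ≤ d) (hq : q < ((d : ℝ) + 4) / ((d : ℝ) + 2))
    (v : EuclideanSpace ℝ (Fin d)) {V : Matrix (Fin d) (Fin d) ℝ} (hV : V.PosDef) :
    Integrable (tsallisIntegrand q (qGaussian q v V)) volume ∧
      tsallisEntropy q (qGaussian q v V) = qEntropyOfDet q d V.det := by
  have hdet := hV.det_pos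
  have hc := qC1_pos hq
  have hC := qC0_pos hq
  set K := qC0 q d * V.det ^ (-(1 / 2) : ℝ) with hK
  have hK0 : 0 < K := mul_pos hC (Real.rpow_pos_of_pos hdet _)
  set a := if q = 1 then Real.log K else (K ^ (1 - q) - 1) / (1 - q) with ha
  set b := if q = 1 then -(1 / 2) * qC1 q d else K ^ (1 - q) * (-(1 / 2) * qC1 q d) with hb
  have hae : tsallisIntegrand q (qGaussian q v V) =ᵐ[volume] fun x =>
      (a + b * (WithLp.ofLp (x - v) ⬝ᵥ (V⁻¹ *ᵥ WithLp.ofLp (x - v)))) * qGaussianPDF q v V x := by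
    filter_upwards [Measure.rnDeriv_withDensity (volume : Measure (EuclideanSpace ℝ (Fin d)))
      (measurable_qGaussianPDF q v V).ennreal_ofReal] with x hx
    rw [tsallisIntegrand, qGaussian, hx, ENNReal.toReal_ofReal (qGaussianPDF_nonneg hq v x hdet.le)]
    have hs := hV.inv.posSemidef.dotProduct_mulVec_nonneg (WithLp.ofLp (x - v))
    rw [star_trivial] at hs
    rw [qGaussianPDF, ← hK, mul_qLog_qExp hK0 hc hs]
    ring
  have := isProbabilityMeasure_qGaussian hd hq v hV
  obtain ⟨i1, e1⟩ := integrable_quadratic_qGaussian hd hq v hV V⁻¹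
  have i2 : Integrable (fun x => a + b * (WithLp.ofLp (x - v) ⬝ᵥ (V⁻¹ *ᵥ WithLp.ofLp (x - v))))
      (qGaussian q v V) := (integrable_const a).add (i1.const_mul b)
  refine ⟨((integrable_qGaussian_iff hq v hdet.le).1 i2).congr hae.symm, ?_⟩
  rw [tsallisEntropy, integral_congr_ae hae, ← integral_qGaussian hq v hdet.le,
    integral_add (integrable_const a) (i1.const_mul b), integral_const_mul, e1,
    nonsing_inv_mul _ hdet.ne'.isUnit]
  simp only [integral_const, probReal_univ, one_smul, trace_one, Fintype.card_fin]
  rw [qEntropyOfDet, ha, hb]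
  by_cases h : q = 1
  · simp only [if_pos h]
    rw [hK, Real.log_mul hC.ne' (Real.rpow_pos_of_pos hdet _).ne', Real.log_rpow hdet, h, qC1_one]
    ring
  · simp only [if_neg h]
    have h1 : 1 - q ≠ 0 := sub_ne_zero.2 (Ne.symm h)
    have h2 := (qC1_denom_pos hq).ne'
    rw [hK, Real.mul_rpow hC.le (Real.rpow_nonneg hdet.le _), ← Real.rpow_mul hdet.le,
      show -(1 / 2) * (1 - q) = (q - 1) / 2 by ring, qM, qC1]
    generalize qC0 q d ^ (1 - q) = x
    generalize V.det ^ ((q - 1) / 2) = y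
    obtain ⟨D, hD⟩ : ∃ D, D = 2 + ((d : ℝ) + 2) * (1 - q) := ⟨_, rfl⟩
    rw [← hD] at h2 ⊢
    field_simp
    linear_combination x * y * hD

end Entropy

/-! ### Optimal transport matrices and trace inequalities. -/

section Transport

variable {d : ℕ} {X Y A T W : Matrix (Fin d) (Fin d) ℝ}

/-- The matrix of the optimal transport map from the centred law with covariance `X` to the one
with covariance `A`. -/
noncomputable def transportMatrix (X A : Matrix (Fin d) (Fin d) ℝ) : Matrix (Fin d) (Fin d) ℝ :=
  (CFC.sqrt X)⁻¹ * CFC.sqrt (CFC.sqrt X * A * CFC.sqrt X) * (CFC.sqrt X)⁻¹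

theorem Matrix.PosDef.mul_mul_self (hA : A.PosDef) (hX : X.PosDef) : (X * A * X).PosDef := by
  have h := hA.mul_mul_conjTranspose_same (B := X) (vecMul_injective_iff_isUnit.2 hX.isUnit)
  rwa [hX.isHermitian.eq] at h

theorem Matrix.PosDef.transportMatrix (hX : X.PosDef) (hA : A.PosDef) :
    (transportMatrix X A).PosDef :=
  (hA.mul_mul_self hX.posDef_sqrt).posDef_sqrt.mul_mul_self hX.posDef_sqrt.inv

theorem sqrt_mul_transportMatrix_mul_sqrt (hX : X.PosDef) (A : Matrix (Fin d) (Fin d) ℝ) :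
    CFC.sqrt X * transportMatrix X A * CFC.sqrt X = CFC.sqrt (CFC.sqrt X * A * CFC.sqrt X) := by
  have hu : IsUnit (CFC.sqrt X).det := hX.posDef_sqrt.det_pos.ne'.isUnit
  rw [transportMatrix, ← mul_assoc, mul_assoc (_ * _) _ (CFC.sqrt X), nonsing_inv_mul _ hu,
    ← mul_assoc, mul_nonsing_inv _ hu, one_mul, mul_one]

theorem transportMatrix_mul_mul (hX : X.PosDef) (hA : A.PosDef) :
    transportMatrix X A * X * transportMatrix X A = A := by
  have hu : IsUnit (CFC.sqrt X).det := hX.posDef_sqrt.det_pos.ne'.isUnit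
  have h1 := CFC.sqrt_mul_sqrt_self X hX.posSemidef.nonneg
  have h2 := CFC.sqrt_mul_sqrt_self _ (hA.mul_mul_self hX.posDef_sqrt).posSemidef.nonneg
  have h3 : transportMatrix X A * CFC.sqrt X =
      (CFC.sqrt X)⁻¹ * CFC.sqrt (CFC.sqrt X * A * CFC.sqrt X) := by
    rw [transportMatrix, mul_assoc _ _ (CFC.sqrt X), nonsing_inv_mul _ hu, mul_one]
  have h4 : CFC.sqrt X * transportMatrix X A =
      CFC.sqrt (CFC.sqrt X * A * CFC.sqrt X) * (CFC.sqrt X)⁻¹ := by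
    rw [transportMatrix, ← mul_assoc, ← mul_assoc, mul_nonsing_inv _ hu, one_mul]
  calc transportMatrix X A * X * transportMatrix X A
      = (transportMatrix X A * CFC.sqrt X) * (CFC.sqrt X * transportMatrix X A) := by
        rw [mul_assoc _ (CFC.sqrt X), ← mul_assoc (CFC.sqrt X) (CFC.sqrt X), h1, ← mul_assoc]
    _ = (CFC.sqrt X)⁻¹ * (CFC.sqrt (CFC.sqrt X * A * CFC.sqrt X) *
          CFC.sqrt (CFC.sqrt X * A * CFC.sqrt X)) * (CFC.sqrt X)⁻¹ := by
        rw [h3, h4]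
        simp only [mul_assoc]
    _ = A := by
        rw [h2, mul_assoc (CFC.sqrt X), ← mul_assoc, nonsing_inv_mul _ hu, one_mul, mul_assoc,
          mul_nonsing_inv _ hu, mul_one]

theorem Matrix.PosSemidef.trace_mul_nonneg (hX : X.PosSemidef) (hY : Y.PosSemidef) :
    0 ≤ (X * Y).trace := by
  obtain ⟨B, rfl⟩ := CStarAlgebra.nonneg_iff_eq_star_mul_self.mp hY.nonneg
  rw [← mul_assoc, trace_mul_comm, ← mul_assoc]
  exact (hX.mul_mul_conjTranspose_same B).trace_nonneg

/-- Writes the duality gap of the trial matrix W as a square. Nonnegativity gives the affine upper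
bounds on 2 tr(TY), and definiteness gives the equality case T = W. -/
theorem trace_mul_add_trace_inv_mul_sub (hW : W.PosDef) (hTYA : T * Y * T = A) :
    (W * Y).trace + (W⁻¹ * A).trace - 2 * (T * Y).trace =
      ((T - W) * W⁻¹ * (T - W) * Y).trace := by
  have hu : IsUnit W.det := hW.det_pos.ne'.isUnit
  have h1 : (T - W) * W⁻¹ * (T - W) = T * W⁻¹ * T - T - T + W := by
    rw [sub_mul, mul_nonsing_inv _ hu, sub_mul, one_mul, mul_sub, mul_assoc T W⁻¹ W,
      nonsing_inv_mul _ hu, mul_one]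
    abel
  have h2 : (T * W⁻¹ * T * Y).trace = (W⁻¹ * A).trace := by
    rw [← hTYA, mul_assoc, mul_assoc, trace_mul_comm, mul_assoc]
  rw [h1, add_mul, sub_mul, sub_mul, trace_add, trace_sub, trace_sub, h2]
  ring

theorem two_mul_trace_le (hW : W.PosDef) (hT : T.IsHermitian) (hY : Y.PosDef)
    (hTYA : T * Y * T = A) : 2 * (T * Y).trace ≤ (W * Y).trace + (W⁻¹ * A).trace := by
  have h := trace_mul_add_trace_inv_mul_sub hW hTYA
  have h1 : ((T - W) * W⁻¹ * (T - W)).PosSemidef := by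
    have := hW.inv.posSemidef.mul_mul_conjTranspose_same (T - W)
    rwa [(hT.sub hW.isHermitian).eq] at this
  have := h1.trace_mul_nonneg hY.posSemidef
  linarith

theorem eq_of_trace_mul_add_le (hW : W.PosDef) (hT : T.IsHermitian) (hY : Y.PosDef)
    (hTYA : T * Y * T = A) (h : (W * Y).trace + (W⁻¹ * A).trace ≤ 2 * (T * Y).trace) : T = W := by
  have h0 := trace_mul_add_trace_inv_mul_sub hW hTYA
  have hD := (hT.sub hW.isHermitian).eq
  have h1 : ((T - W) * W⁻¹ * (T - W)).PosSemidef := by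
    have := hW.inv.posSemidef.mul_mul_conjTranspose_same (T - W)
    rwa [hD] at this
  have h2 : ((T - W) * W⁻¹ * (T - W) * Y).trace = 0 :=
    le_antisymm (by linarith) (h1.trace_mul_nonneg hY.posSemidef)
  obtain ⟨B, hB, rfl⟩ := hY.exists_mul_transpose_eq
  -- With Y = BBᵀ the gap is the trace of a positive semidefinite matrix, which must then vanish;
  -- factoring W⁻¹ = CCᵀ and cancelling the invertible B and C leaves T - W = 0.
  have h3 : ((Bᵀ * (T - W)) * W⁻¹ * (Bᵀ * (T - W))ᴴ).trace = 0 := by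
    rw [conjTranspose_mul, hD, ← h2, conjTranspose_eq_transpose_of_trivial, transpose_transpose]
    conv_rhs => rw [← mul_assoc, trace_mul_comm]
    simp only [mul_assoc]
  rw [(hW.inv.posSemidef.mul_mul_conjTranspose_same _).trace_eq_zero_iff] at h3
  obtain ⟨C, hC, hCW⟩ := hW.inv.exists_mul_transpose_eq
  have h4 : (Bᵀ * (T - W) * C) * (Bᵀ * (T - W) * C)ᴴ = 0 := by
    rw [conjTranspose_mul _ C, ← h3, ← hCW, conjTranspose_eq_transpose_of_trivial C]
    simp only [mul_assoc]
  rw [self_mul_conjTranspose_eq_zero] at h4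
  have hBu : IsUnit Bᵀ := by rw [isUnit_iff_isUnit_det, det_transpose]; exact hB.isUnit
  have hCu : IsUnit C := (isUnit_iff_isUnit_det C).2 hC.isUnit
  rw [hCu.mul_left_eq_zero, hBu.mul_right_eq_zero, sub_eq_zero] at h4
  exact h4

/-- If x has covariance X, then (Bx, Tx) couples covariances BXBᵀ and A with correlation tr(BXT),
which cannot exceed the optimal one. Algebraically, twice the difference is tr((T'B - T)ᵀT'⁻¹(T'B -
T)X). -/
theorem trace_mul_mul_le_of_conj {B T' : Matrix (Fin d) (Fin d) ℝ} (hX : X.PosDef)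
    (hT : T.IsHermitian) (hT' : T'.PosDef) (hTXA : T * X * T = A)
    (hT'YA : T' * (B * X * Bᵀ) * T' = A) :
    (B * X * T).trace ≤ (T' * (B * X * Bᵀ)).trace := by
  have hu : IsUnit T'.det := hT'.det_pos.ne'.isUnit
  have hTt : Tᵀ = T := by simpa using hT.eq
  have h1 : 0 ≤ ((T' * B - T)ᵀ * T'⁻¹ * (T' * B - T) * X).trace := by
    have := hT'.inv.posSemidef.conjTranspose_mul_mul_same (T' * B - T)
    exact this.trace_mul_nonneg hX.posSemidef
  have h2 : (T' * B - T)ᵀ * T'⁻¹ * (T' * B - T) * X =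
      Bᵀ * (T' * B * X) - Bᵀ * (T * X) - T * (B * X) + T * (T'⁻¹ * (T * X)) := by
    have e1 : T' * (T'⁻¹ * (T * X)) = T * X := by
      rw [← mul_assoc, mul_nonsing_inv _ hu, one_mul]
    have e2 : T'⁻¹ * (T' * (B * X)) = B * X := by rw [← mul_assoc, nonsing_inv_mul _ hu, one_mul]
    rw [transpose_sub, transpose_mul, hTt, hT'.transpose_eq_self]
    simp only [sub_mul, mul_sub, mul_assoc, e1, e2]
    abel
  have h3 : (Bᵀ * (T' * B * X)).trace = (T' * (B * X * Bᵀ)).trace := by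
    rw [trace_mul_comm]
    simp only [mul_assoc]
  have h4 : (Bᵀ * (T * X)).trace = (B * X * T).trace := by
    rw [← trace_transpose, transpose_mul, transpose_mul, hX.transpose_eq_self, hTt,
      transpose_transpose, mul_assoc, trace_mul_comm]
    simp only [mul_assoc]
    rw [trace_mul_comm, mul_assoc]
  have h5 : (T * (B * X)).trace = (B * X * T).trace := trace_mul_comm _ _
  have h6 : (T * (T'⁻¹ * (T * X))).trace = (T' * (B * X * Bᵀ)).trace := by
    rw [trace_mul_comm, mul_assoc, hTXA, ← hT'YA, mul_assoc T' _ T', ← mul_assoc T'⁻¹,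
      nonsing_inv_mul _ hu, one_mul, trace_mul_comm]
  rw [h2, trace_add, trace_sub, trace_sub, h3, h4, h5, h6] at h1
  linarith

end Transport

/-! ### Convexity of the entropy in the covariance matrix. -/

section DetEntropy

variable {d : ℕ} {q : ℝ}

/-- AM-GM for the eigenvalues, from the tangent line of log at their mean. -/
theorem Matrix.PosDef.log_det_le (hd : 1 ≤ d) {Z : Matrix (Fin d) (Fin d) ℝ} (hZ : Z.PosDef) :
    0 < Z.trace ∧ Real.log Z.det ≤ d * Real.log (Z.trace / d) := by
  have : Nonempty (Fin d) := ⟨⟨0, hd⟩⟩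
  have hd0 : (0 : ℝ) < d := by exact_mod_cast hd
  have htr : 0 < Z.trace := hZ.trace_pos
  refine ⟨htr, ?_⟩
  have hpos := hZ.eigenvalues_pos
  have htr' := hZ.isHermitian.trace_eq_sum_eigenvalues
  rw [hZ.isHermitian.det_eq_prod_eigenvalues]
  simp only [RCLike.ofReal_real_eq_id, id_eq] at htr' ⊢
  rw [Real.log_prod fun i _ => (hpos i).ne']
  set τ := Z.trace / d with hτ
  have hτ0 : 0 < τ := by positivity
  calc ∑ i, Real.log (hZ.isHermitian.eigenvalues i)
      ≤ ∑ i, (Real.log τ + (hZ.isHermitian.eigenvalues i / τ - 1)) := by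
        refine Finset.sum_le_sum fun i _ => ?_
        have := Real.log_le_sub_one_of_pos (div_pos (hpos i) hτ0)
        rw [Real.log_div (hpos i).ne' hτ0.ne'] at this
        linarith
    _ = d * Real.log τ := by
        rw [Finset.sum_add_distrib, Finset.sum_sub_distrib, ← Finset.sum_div, ← htr', hτ]
        simp
        field_simp
        ring

theorem qM_pos (hd : 1 ≤ d) (hq : q < ((d : ℝ) + 4) / ((d : ℝ) + 2)) : 0 < qM q d := by
  have h1 := qC1_denom_pos hq
  have h2 : q < 2 := (lt_two_of_lt hq).resolve_right (by omega)
  have h3 : 0 < 2 - q := by linarith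
  have := Real.rpow_pos_of_pos (qC0_pos hq) (1 - q)
  unfold qM
  positivity

theorem qM_one (d : ℕ) : qM 1 d = 1 := by simp [qM]; norm_num

theorem hasDerivAt_qEntropyOfDet {t : ℝ} (ht : 0 < t) :
    HasDerivAt (qEntropyOfDet q d) (-(1 / 2) * qM q d * t ^ ((q - 1) / 2) / t) t := by
  unfold qEntropyOfDet
  by_cases h : q = 1
  · simp only [if_pos h]
    have := ((Real.hasDerivAt_log ht.ne').const_mul (1 / 2)).const_sub (Real.log (qC0 q d) - d / 2)
    convert! this using 1
    rw [h, qM_one]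
    simp
    ring
  · simp only [if_neg h]
    have h1 : 1 - q ≠ 0 := sub_ne_zero.2 (Ne.symm h)
    have := (((Real.hasDerivAt_rpow_const (p := (q - 1) / 2) (Or.inl ht.ne')).const_mul
      (qM q d)).sub_const 1).div_const (1 - q)
    convert! this using 1
    rw [Real.rpow_sub_one ht.ne']
    field_simp
    ring

/-- For s < 0 the bound exp x ≥ 1 + x and log r ≤ τ - d suffice. For s > 0 one needs the concave
Bernoulli inequality for (τ/d)^(sd), which is where sd ≤ 1 enters. -/
theorem Real.rpow_sub_one_div_le (hd : 1 ≤ d) {r s τ : ℝ} (hr : 0 < r) (hτ : 0 < τ) (hs : s ≠ 0)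
    (hsd : s * d ≤ 1) (h : Real.log r ≤ d * Real.log (τ / d)) : (r ^ s - 1) / s ≤ τ - d := by
  have hd0 : (0 : ℝ) < d := by exact_mod_cast hd
  have hlog := Real.log_le_sub_one_of_pos (div_pos hτ hd0)
  have h1 : Real.log r ≤ τ - d := by
    refine h.trans ((mul_le_mul_of_nonneg_left hlog hd0.le).trans (le_of_eq ?_))
    field_simp
  have hexp : r ^ s = Real.exp (Real.log r * s) := Real.rpow_def_of_pos hr s
  rcases lt_or_gt_of_ne hs with hs | hs
  · rw [div_le_iff_of_neg hs, hexp]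
    have := Real.add_one_le_exp (Real.log r * s)
    nlinarith
  · rw [div_le_iff₀ hs]
    have h2 : r ^ s ≤ (1 + (τ / d - 1)) ^ (s * d) := by
      rw [hexp, add_sub_cancel, Real.rpow_def_of_pos (by positivity)]
      apply Real.exp_le_exp.2
      nlinarith
    have h3 := rpow_one_add_le_one_add_mul_self (s := τ / d - 1) (p := s * d)
      (by have := div_pos hτ hd0; linarith) (by positivity) hsd
    have h4 : s * d * (τ / d - 1) = s * (τ - d) := by field_simp
    linarith

theorem qEntropyOfDet_sub_ge (hd : 1 ≤ d) (hq : q < ((d : ℝ) + 4) / ((d : ℝ) + 2)) {t r τ : ℝ}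
    (ht : 0 < t) (hr : 0 < r) (hτ : 0 < τ) (h : Real.log r ≤ d * Real.log (τ / d)) :
    -(1 / 2) * qM q d * t ^ ((q - 1) / 2) * (τ - d) ≤
      qEntropyOfDet q d (t * r) - qEntropyOfDet q d t := by
  have hd0 : (0 : ℝ) < d := by exact_mod_cast hd
  unfold qEntropyOfDet
  by_cases h1 : q = 1
  · simp only [if_pos h1]
    have hlog := Real.log_le_sub_one_of_pos (div_pos hτ hd0)
    have h2 : Real.log r ≤ τ - d := by
      refine h.trans ((mul_le_mul_of_nonneg_left hlog hd0.le).trans (le_of_eq ?_))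
      field_simp
    rw [Real.log_mul ht.ne' hr.ne', h1, qM_one]
    simp
    linarith
  · simp only [if_neg h1]
    have hs : (q - 1) / 2 ≠ 0 := div_ne_zero (sub_ne_zero.2 h1) two_ne_zero
    have hq1 : 1 - q ≠ 0 := sub_ne_zero.2 (Ne.symm h1)
    have hsd : (q - 1) / 2 * d ≤ 1 := by
      have := qC1_denom_pos hq
      rcases le_or_gt q 1 with hq2 | hq2 <;> nlinarith
    have h3 := Real.rpow_sub_one_div_le hd hr hτ hs hsd h
    have hpos := mul_pos (qM_pos hd hq) (Real.rpow_pos_of_pos ht ((q - 1) / 2))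
    have h4 := mul_le_mul_of_nonneg_left h3 hpos.le
    rw [Real.mul_rpow ht.le hr.le]
    have h5 : (qM q d * (t ^ ((q - 1) / 2) * r ^ ((q - 1) / 2)) - 1) / (1 - q) -
        (qM q d * t ^ ((q - 1) / 2) - 1) / (1 - q) =
        -(1 / 2) * (qM q d * t ^ ((q - 1) / 2) * ((r ^ ((q - 1) / 2) - 1) / ((q - 1) / 2))) := by
      have : q - 1 ≠ 0 := sub_ne_zero.2 h1
      rw [show 1 - q = -(q - 1) by ring]
      field_simp
      ring
    rw [h5]
    linarith

/-- The left side is the differential of the entropy at X applied to Y - X, so this is the tangent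
inequality of a convex function. Congruence by B with BBᵀ = X⁻¹ reduces it to comparing the
determinant and trace of BᵀYB. -/
theorem qEntropyOfDet_det_sub_ge (hd : 1 ≤ d) (hq : q < ((d : ℝ) + 4) / ((d : ℝ) + 2))
    {X Y : Matrix (Fin d) (Fin d) ℝ} (hX : X.PosDef) (hY : Y.PosDef) :
    -(1 / 2) * qM q d * X.det ^ ((q - 1) / 2) * ((X⁻¹ * Y).trace - d) ≤
      qEntropyOfDet q d Y.det - qEntropyOfDet q d X.det := by
  obtain ⟨B, hB, hBX⟩ := hX.inv.exists_mul_transpose_eq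
  have hBu : IsUnit B := (isUnit_iff_isUnit_det B).2 hB.isUnit
  have hZ : (Bᵀ * Y * B).PosDef :=
    hY.conjTranspose_mul_mul_same (B := B) (mulVec_injective_iff_isUnit.2 hBu)
  have htr : (Bᵀ * Y * B).trace = (X⁻¹ * Y).trace := by
    rw [← hBX, trace_mul_comm, mul_assoc, ← mul_assoc]
  have hdet : X.det * (Bᵀ * Y * B).det = Y.det := by
    have h1 : B.det * Bᵀ.det * X.det = 1 := by
      rw [← det_mul, ← det_mul, hBX, nonsing_inv_mul _ hX.det_pos.ne'.isUnit, det_one]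
    rw [det_mul, det_mul]
    linear_combination Y.det * h1
  obtain ⟨h1, h2⟩ := hZ.log_det_le hd
  have := qEntropyOfDet_sub_ge hd hq hX.det_pos hZ.det_pos h1 h2
  rwa [hdet, htr] at this

end DetEntropy

/-! ### The objective on matrices: convexity, stationarity and uniqueness. -/

section Objective

variable {d n : ℕ} {q γ : ℝ} {w : Fin n → ℝ} {A : Fin n → Matrix (Fin d) (Fin d) ℝ}
  {X Y : Matrix (Fin d) (Fin d) ℝ}

/-- The penalized objective at a centred `q`-Gaussian measure, as a function of its covariance
matrix. -/
noncomputable def matrixObjective (q γ : ℝ) (w : Fin n → ℝ) (A : Fin n → Matrix (Fin d) (Fin d) ℝ)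
    (X : Matrix (Fin d) (Fin d) ℝ) : ℝ :=
  ∑ i, 1 / 2 * w i * (X.trace + (A i).trace - 2 * (transportMatrix X (A i) * X).trace) +
    γ * qEntropyOfDet q d X.det

/-- The average of the optimal transport matrices from `X` to the `A i`. -/
noncomputable def meanTransport (w : Fin n → ℝ) (A : Fin n → Matrix (Fin d) (Fin d) ℝ)
    (X : Matrix (Fin d) (Fin d) ℝ) : Matrix (Fin d) (Fin d) ℝ :=
  ∑ i, w i • transportMatrix X (A i)

/-- The multiplier `γ m(q,d) (det X)^((q-1)/2)` in the stationarity equation. -/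
noncomputable def stationaryMultiplier (q γ : ℝ) (X : Matrix (Fin d) (Fin d) ℝ) : ℝ :=
  γ * qM q d * X.det ^ ((q - 1) / 2)

theorem trace_mul_meanTransport (w : Fin n → ℝ) (A : Fin n → Matrix (Fin d) (Fin d) ℝ)
    (X B : Matrix (Fin d) (Fin d) ℝ) :
    (B * meanTransport w A X).trace = ∑ i, w i * (B * transportMatrix X (A i)).trace := by
  simp only [meanTransport, Finset.mul_sum, trace_sum, mul_smul_comm, trace_smul, smul_eq_mul]

theorem trace_inv_transportMatrix_mul (hX : X.PosDef) {A : Matrix (Fin d) (Fin d) ℝ}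
    (hA : A.PosDef) : ((transportMatrix X A)⁻¹ * A).trace = (transportMatrix X A * X).trace := by
  have hu : IsUnit (transportMatrix X A).det := (hX.transportMatrix hA).det_pos.ne'.isUnit
  have h := transportMatrix_mul_mul hX hA
  generalize transportMatrix X A = T at *
  rw [← h, mul_assoc T, ← mul_assoc, nonsing_inv_mul _ hu, one_mul, trace_mul_comm]

/-- The tangent inequality at X with its transport remainder retained. Stationarity cancels the
linear terms, leaving the gaps of `two_mul_trace_le` with trial matrices `transportMatrix X (A i)`:
their signs give minimality, their vanishing gives uniqueness. -/
theorem matrixObjective_sub_ge (hd : 1 ≤ d) (hq : q < ((d : ℝ) + 4) / ((d : ℝ) + 2))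
    (hγ : 0 ≤ γ) (hw : ∑ i, w i = 1) (hA : ∀ i, (A i).PosDef)
    (hX : X.PosDef) (hXeq : X - X * meanTransport w A X = stationaryMultiplier q γ X • 1)
    (hY : Y.PosDef) :
    ∑ i, 1 / 2 * w i * ((transportMatrix X (A i) * Y).trace +
      ((transportMatrix X (A i))⁻¹ * A i).trace - 2 * (transportMatrix Y (A i) * Y).trace) ≤
      matrixObjective q γ w A Y - matrixObjective q γ w A X := by
  have hu : IsUnit X.det := hX.det_pos.ne'.isUnit
  have hE := mul_le_mul_of_nonneg_left (qEntropyOfDet_det_sub_ge hd hq hX hY) hγ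
  have h1 : 1 - meanTransport w A X = stationaryMultiplier q γ X • X⁻¹ := by
    have := congrArg (X⁻¹ * ·) hXeq
    simpa [mul_sub, ← mul_assoc, nonsing_inv_mul _ hu] using this
  have h2 : Y.trace - (Y * meanTransport w A X).trace =
      stationaryMultiplier q γ X * (X⁻¹ * Y).trace := by
    have := congrArg (fun M => (Y * M).trace) h1
    simpa [mul_sub, trace_sub, trace_mul_comm Y X⁻¹] using this
  have h3 : X.trace - (X * meanTransport w A X).trace = stationaryMultiplier q γ X * d := by
    have := congrArg (fun M => M.trace) hXeq
    simpa [trace_sub] using this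
  rw [trace_mul_meanTransport] at h2 h3
  have hYs : Y.trace = ∑ i, w i * Y.trace := by rw [← Finset.sum_mul, hw, one_mul]
  have hXs : X.trace = ∑ i, w i * X.trace := by rw [← Finset.sum_mul, hw, one_mul]
  rw [hYs, ← Finset.sum_sub_distrib] at h2
  rw [hXs, ← Finset.sum_sub_distrib] at h3
  have h4 : ∑ i, 1 / 2 * w i * ((transportMatrix X (A i) * Y).trace +
      ((transportMatrix X (A i))⁻¹ * A i).trace - 2 * (transportMatrix Y (A i) * Y).trace) =
      (∑ i, 1 / 2 * w i * (Y.trace + (A i).trace - 2 * (transportMatrix Y (A i) * Y).trace)) -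
      (∑ i, 1 / 2 * w i * (X.trace + (A i).trace - 2 * (transportMatrix X (A i) * X).trace)) -
      1 / 2 * (∑ i, (w i * Y.trace - w i * (Y * transportMatrix X (A i)).trace)) +
      1 / 2 * (∑ i, (w i * X.trace - w i * (X * transportMatrix X (A i)).trace)) := by
    rw [Finset.mul_sum, Finset.mul_sum, ← Finset.sum_sub_distrib, ← Finset.sum_sub_distrib,
      ← Finset.sum_add_distrib]
    refine Finset.sum_congr rfl fun i _ => ?_
    rw [trace_inv_transportMatrix_mul hX (hA i), trace_mul_comm Y, trace_mul_comm X]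
    ring
  rw [h4, h2, h3]
  unfold matrixObjective
  unfold stationaryMultiplier
  linarith

theorem matrixObjective_le_of_stationary (hd : 1 ≤ d) (hq : q < ((d : ℝ) + 4) / ((d : ℝ) + 2))
    (hγ : 0 ≤ γ) (hw0 : ∀ i, 0 ≤ w i) (hw : ∑ i, w i = 1) (hA : ∀ i, (A i).PosDef)
    (hX : X.PosDef) (hXeq : X - X * meanTransport w A X = stationaryMultiplier q γ X • 1)
    (hY : Y.PosDef) : matrixObjective q γ w A X ≤ matrixObjective q γ w A Y := by
  have h := matrixObjective_sub_ge hd hq hγ hw hA hX hXeq hY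
  have h1 : 0 ≤ ∑ i, 1 / 2 * w i * ((transportMatrix X (A i) * Y).trace +
      ((transportMatrix X (A i))⁻¹ * A i).trace - 2 * (transportMatrix Y (A i) * Y).trace) := by
    refine Finset.sum_nonneg fun i _ => mul_nonneg (by linarith [hw0 i]) ?_
    have := two_mul_trace_le (hX.transportMatrix (hA i)) (hY.transportMatrix (hA i)).isHermitian
      hY (transportMatrix_mul_mul hY (hA i))
    linarith
  linarith

/-- Some weight is positive, and for that index the gap must vanish. Then X and Y have the same
transport matrix T to A i, and T can be cancelled in TYT = A i = TXT. -/
theorem eq_of_matrixObjective_le_of_stationary (hd : 1 ≤ d)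
    (hq : q < ((d : ℝ) + 4) / ((d : ℝ) + 2))
    (hγ : 0 ≤ γ) (hw0 : ∀ i, 0 ≤ w i) (hw : ∑ i, w i = 1) (hA : ∀ i, (A i).PosDef)
    (hX : X.PosDef) (hXeq : X - X * meanTransport w A X = stationaryMultiplier q γ X • 1)
    (hY : Y.PosDef) (hle : matrixObjective q γ w A Y ≤ matrixObjective q γ w A X) : Y = X := by
  have h := matrixObjective_sub_ge hd hq hγ hw hA hX hXeq hY
  obtain ⟨i, hi⟩ : ∃ i, 0 < w i := by
    by_contra! hcon
    have := Finset.sum_nonpos fun i (_ : i ∈ Finset.univ) => hcon i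
    linarith
  have hnn : ∀ i ∈ Finset.univ, 0 ≤ 1 / 2 * w i * ((transportMatrix X (A i) * Y).trace +
      ((transportMatrix X (A i))⁻¹ * A i).trace - 2 * (transportMatrix Y (A i) * Y).trace) := by
    refine fun i _ => mul_nonneg (by linarith [hw0 i]) ?_
    have := two_mul_trace_le (hX.transportMatrix (hA i)) (hY.transportMatrix (hA i)).isHermitian
      hY (transportMatrix_mul_mul hY (hA i))
    linarith
  have h1 := (Finset.single_le_sum hnn (Finset.mem_univ i)).trans (h.trans (sub_nonpos.2 hle))
  have h2 : (transportMatrix X (A i) * Y).trace + ((transportMatrix X (A i))⁻¹ * A i).trace ≤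
      2 * (transportMatrix Y (A i) * Y).trace := by
    by_contra! hcon
    have : 0 < 1 / 2 * w i * ((transportMatrix X (A i) * Y).trace +
      ((transportMatrix X (A i))⁻¹ * A i).trace - 2 * (transportMatrix Y (A i) * Y).trace) :=
      mul_pos (by linarith) (by linarith)
    linarith
  have hTX := transportMatrix_mul_mul hX (hA i)
  have hTY := transportMatrix_mul_mul hY (hA i)
  have hT := hX.transportMatrix (hA i)
  rw [eq_of_trace_mul_add_le hT (hY.transportMatrix (hA i)).isHermitian hY hTY h2] at hTY
  replace hTY := hTY.trans hTX.symm
  exact hT.isUnit.mul_right_injective (hT.isUnit.mul_left_injective hTY)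

/-! ### First variation along congruences. -/

theorem hasDerivAt_det_one_add_smul (H : Matrix (Fin d) (Fin d) ℝ) :
    HasDerivAt (fun t : ℝ => (1 + t • H).det) H.trace 0 := by
  rw [funext fun t : ℝ => det_one_add_smul t H]
  generalize (1 + (Polynomial.X : Polynomial ℝ) • H.map Polynomial.C).det.divX.divX = p
  have h := (((hasDerivAt_id (0 : ℝ)).const_mul H.trace).const_add 1).add
    ((p.hasDerivAt 0).mul ((hasDerivAt_id (0 : ℝ)).pow 2))
  convert! h using 1
  simp

/-- The congruence transform `(1 + tH) X (1 + tH)ᵀ`. -/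
noncomputable def congrPath (X H : Matrix (Fin d) (Fin d) ℝ) (t : ℝ) : Matrix (Fin d) (Fin d) ℝ :=
  (1 + t • H) * X * (1 + t • H)ᵀ

theorem trace_congrPath (hX : X.PosDef) (H : Matrix (Fin d) (Fin d) ℝ) (t : ℝ) :
    (congrPath X H t).trace = X.trace + 2 * t * (H * X).trace + t ^ 2 * (H * X * Hᵀ).trace := by
  have h : (X * Hᵀ).trace = (H * X).trace := by
    rw [← trace_transpose, transpose_mul, transpose_transpose, hX.transpose_eq_self]
  have h1 : congrPath X H t = X + t • (H * X) + t • (X * Hᵀ) + (t ^ 2) • (H * X * Hᵀ) := by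
    simp only [congrPath, transpose_add, transpose_one, transpose_smul, add_mul, mul_add, one_mul,
      mul_one, smul_mul_assoc, mul_smul_comm, smul_add, smul_smul, sq]
    abel
  rw [h1]
  simp only [trace_add, trace_smul, smul_eq_mul, h]
  ring

theorem posDef_congrPath (hX : X.PosDef) {H : Matrix (Fin d) (Fin d) ℝ} {t : ℝ}
    (ht : (1 + t • H).det ≠ 0) : (congrPath X H t).PosDef := by
  have h := hX.mul_mul_conjTranspose_same (B := 1 + t • H)
    (vecMul_injective_iff_isUnit.2 ((isUnit_iff_isUnit_det _).2 ht.isUnit))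
  rwa [conjTranspose_eq_transpose_of_trivial] at h

/-- A majorant of the objective along `congrPath`, obtained from suboptimal couplings. -/
noncomputable def objectiveMajorant (q γ : ℝ) (w : Fin n → ℝ)
    (A : Fin n → Matrix (Fin d) (Fin d) ℝ) (X H : Matrix (Fin d) (Fin d) ℝ) (t : ℝ) : ℝ :=
  ∑ i, 1 / 2 * w i * (X.trace + 2 * t * (H * X).trace + t ^ 2 * (H * X * Hᵀ).trace +
    (A i).trace - 2 * ((transportMatrix X (A i) * X).trace +
      t * (H * X * transportMatrix X (A i)).trace)) +
    γ * qEntropyOfDet q d ((1 + t • H).det ^ 2 * X.det)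

theorem objectiveMajorant_zero (q γ : ℝ) (w : Fin n → ℝ) (A : Fin n → Matrix (Fin d) (Fin d) ℝ)
    (X H : Matrix (Fin d) (Fin d) ℝ) :
    objectiveMajorant q γ w A X H 0 = matrixObjective q γ w A X := by
  simp [objectiveMajorant, matrixObjective]

/-- The old transport map is kept while the source is pushed forward by 1 + tH. The resulting cost
is quadratic in t and agrees with the optimal one at t = 0, so at a minimum its derivative replaces
that of the objective. -/
theorem matrixObjective_congrPath_le (γ : ℝ) (hw0 : ∀ i, 0 ≤ w i)
    (hA : ∀ i, (A i).PosDef) (hX : X.PosDef) {H : Matrix (Fin d) (Fin d) ℝ} {t : ℝ}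
    (ht : (1 + t • H).det ≠ 0) :
    matrixObjective q γ w A (congrPath X H t) ≤ objectiveMajorant q γ w A X H t := by
  have hY := posDef_congrPath hX ht
  have hdet : (congrPath X H t).det = (1 + t • H).det ^ 2 * X.det := by
    rw [congrPath, det_mul, det_mul, det_transpose]
    ring
  unfold matrixObjective objectiveMajorant
  rw [hdet, trace_congrPath hX]
  refine add_le_add (Finset.sum_le_sum fun i _ => mul_le_mul_of_nonneg_left ?_
    (by linarith [hw0 i])) le_rfl
  have h := trace_mul_mul_le_of_conj hX (hX.transportMatrix (hA i)).isHermitian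
    (hY.transportMatrix (hA i)) (transportMatrix_mul_mul hX (hA i))
    (transportMatrix_mul_mul hY (hA i))
  have h1 : ((1 + t • H) * X * transportMatrix X (A i)).trace =
      (transportMatrix X (A i) * X).trace + t * (H * X * transportMatrix X (A i)).trace := by
    rw [add_mul, add_mul, one_mul, trace_add, smul_mul_assoc, smul_mul_assoc, trace_smul,
      smul_eq_mul, trace_mul_comm X]
  rw [h1, ← congrPath] at h
  linarith

theorem hasDerivAt_objectiveMajorant (hw : ∑ i, w i = 1) (hX : X.PosDef)
    (H : Matrix (Fin d) (Fin d) ℝ) :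
    HasDerivAt (objectiveMajorant q γ w A X H)
      (H * (X - X * meanTransport w A X - stationaryMultiplier q γ X • 1)).trace 0 := by
  have hdet := hX.det_pos
  have h1 : ∀ i, HasDerivAt (fun t : ℝ => 1 / 2 * w i * (X.trace + 2 * t * (H * X).trace +
      t ^ 2 * (H * X * Hᵀ).trace + (A i).trace - 2 * ((transportMatrix X (A i) * X).trace +
      t * (H * X * transportMatrix X (A i)).trace)))
      (w i * ((H * X).trace - (H * X * transportMatrix X (A i)).trace)) 0 := by
    intro i
    have hid := hasDerivAt_id (0 : ℝ)
    have := ((((((hid.const_mul 2).mul_const (H * X).trace).const_add X.trace).add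
      ((hid.pow 2).mul_const (H * X * Hᵀ).trace)).add_const (A i).trace).sub
      (((hid.mul_const (H * X * transportMatrix X (A i)).trace).const_add
        (transportMatrix X (A i) * X).trace).const_mul 2)).const_mul (1 / 2 * w i)
    convert! this using 1
    simp
    ring
  have h2 : HasDerivAt (fun t : ℝ => (1 + t • H).det ^ 2 * X.det) (2 * H.trace * X.det) 0 := by
    have := ((hasDerivAt_det_one_add_smul H).pow 2).mul_const X.det
    convert! this using 1
    simp
  have h3 : HasDerivAt (fun t : ℝ => qEntropyOfDet q d ((1 + t • H).det ^ 2 * X.det))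
      (-(1 / 2) * qM q d * X.det ^ ((q - 1) / 2) / X.det * (2 * H.trace * X.det)) 0 := by
    have h4 := hasDerivAt_qEntropyOfDet (q := q) (d := d) hdet
    refine HasDerivAt.comp (0 : ℝ) (h₂ := qEntropyOfDet q d) ?_ h2
    simpa using h4
  have h4 := (HasDerivAt.fun_sum fun i (_ : i ∈ Finset.univ) => h1 i).add (h3.const_mul γ)
  convert! h4 using 1
  have hne := hdet.ne'
  have h5 : ∑ i, w i * ((H * X).trace - (H * X * transportMatrix X (A i)).trace) =
      (H * X).trace - (H * X * meanTransport w A X).trace := by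
    rw [trace_mul_meanTransport]
    simp_rw [mul_sub]
    rw [Finset.sum_sub_distrib, ← Finset.sum_mul, hw, one_mul]
  rw [h5, stationaryMultiplier]
  simp only [mul_sub, trace_sub, mul_smul_comm, mul_one, trace_smul, smul_eq_mul, ← mul_assoc]
  field_simp
  ring

theorem HasDerivAt.nonneg_of_eventually_le {f : ℝ → ℝ} {f' : ℝ} (hf : HasDerivAt f f' 0)
    (h : ∀ᶠ t in nhdsWithin (0 : ℝ) (Set.Ioi 0), f 0 ≤ f t) : 0 ≤ f' := by
  have h1 := hf.hasDerivWithinAt (s := Set.Ioi 0)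
  rw [hasDerivWithinAt_iff_tendsto_slope' (by simp)] at h1
  refine ge_of_tendsto h1 ?_
  filter_upwards [h, self_mem_nhdsWithin] with t ht ht0
  rw [slope_def_field, sub_zero]
  exact div_nonneg (sub_nonneg.2 ht) (le_of_lt ht0)

/-- First variation of the objective at a minimizer relative to a constraint set. -/
theorem trace_mul_stationary_nonneg {K : Set (Matrix (Fin d) (Fin d) ℝ)}
    (hw0 : ∀ i, 0 ≤ w i) (hw : ∑ i, w i = 1) (hA : ∀ i, (A i).PosDef) (hX : X.PosDef)
    (hmin : IsMinOn (matrixObjective q γ w A) K X) {H : Matrix (Fin d) (Fin d) ℝ}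
    (hH : ∀ᶠ t in nhdsWithin (0 : ℝ) (Set.Ioi 0), congrPath X H t ∈ K) :
    0 ≤ (H * (X - X * meanTransport w A X - stationaryMultiplier q γ X • 1)).trace := by
  refine (hasDerivAt_objectiveMajorant hw hX H).nonneg_of_eventually_le ?_
  have h1 : ∀ᶠ t in nhdsWithin (0 : ℝ) (Set.Ioi 0), (1 + t • H).det ≠ 0 := by
    refine ((hasDerivAt_det_one_add_smul H).continuousAt.eventually_ne ?_).filter_mono
      nhdsWithin_le_nhds
    simp
  filter_upwards [hH, h1] with t ht ht1
  rw [objectiveMajorant_zero]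
  exact (hmin ht).trans (matrixObjective_congrPath_le γ hw0 hA hX ht1)

end Objective

/-! ### Loewner intervals: compactness and behaviour at the extreme eigenvalues. -/

section LoewnerBox

variable {d : ℕ} {X N A T : Matrix (Fin d) (Fin d) ℝ} {ε R : ℝ}

theorem Matrix.posSemidef_iff_real {N : Matrix (Fin d) (Fin d) ℝ} :
    N.PosSemidef ↔ N.IsHermitian ∧ ∀ x, 0 ≤ x ⬝ᵥ (N *ᵥ x) := by
  rw [posSemidef_iff_dotProduct_mulVec]
  simp only [star_trivial]

theorem dotProduct_self_nonneg_real (x : Fin d → ℝ) : 0 ≤ x ⬝ᵥ x := by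
  simpa only [star_trivial] using dotProduct_star_self_nonneg x

theorem dotProduct_smul_one_mulVec (c : ℝ) (x : Fin d → ℝ) :
    x ⬝ᵥ ((c • (1 : Matrix (Fin d) (Fin d) ℝ)) *ᵥ x) = c * (x ⬝ᵥ x) := by
  rw [smul_mulVec, one_mulVec, dotProduct_smul, smul_eq_mul]

theorem Matrix.smul_one_le_iff :
    ε • (1 : Matrix (Fin d) (Fin d) ℝ) ≤ X ↔ X.IsHermitian ∧ ∀ x, ε * (x ⬝ᵥ x) ≤ x ⬝ᵥ (X *ᵥ x) := by
  have h1 : (ε • (1 : Matrix (Fin d) (Fin d) ℝ)).IsHermitian := isHermitian_one.smul (by simp [IsSelfAdjoint])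
  rw [Matrix.le_iff, posSemidef_iff_real]
  simp only [sub_mulVec, dotProduct_sub, dotProduct_smul_one_mulVec, sub_nonneg]
  refine and_congr_left fun _ => ⟨fun h => ?_, fun h => h.sub h1⟩
  simpa using h.add h1

theorem Matrix.le_smul_one_iff :
    X ≤ R • (1 : Matrix (Fin d) (Fin d) ℝ) ↔ X.IsHermitian ∧ ∀ x, x ⬝ᵥ (X *ᵥ x) ≤ R * (x ⬝ᵥ x) := by
  have h1 : (R • (1 : Matrix (Fin d) (Fin d) ℝ)).IsHermitian := isHermitian_one.smul (by simp [IsSelfAdjoint])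
  rw [Matrix.le_iff, posSemidef_iff_real]
  simp only [sub_mulVec, dotProduct_sub, dotProduct_smul_one_mulVec, sub_nonneg]
  refine and_congr_left fun _ => ⟨fun h => ?_, fun h => h1.sub h⟩
  simpa using h1.sub h

theorem Matrix.posDef_of_smul_one_le (hε : 0 < ε) (h : ε • (1 : Matrix (Fin d) (Fin d) ℝ) ≤ X) :
    X.PosDef := by
  have h1 : (ε • (1 : Matrix (Fin d) (Fin d) ℝ)).PosDef := PosDef.one.smul hε
  have := h1.add_posSemidef (Matrix.le_iff.1 h)
  simpa using this

/-- The matrices between `ε I` and `R I` in the Loewner order. -/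
def loewnerBox (d : ℕ) (ε R : ℝ) : Set (Matrix (Fin d) (Fin d) ℝ) :=
  {X | ε • (1 : Matrix (Fin d) (Fin d) ℝ) ≤ X ∧ X ≤ R • (1 : Matrix (Fin d) (Fin d) ℝ)}

theorem continuous_quadratic (x : Fin d → ℝ) :
    Continuous fun X : Matrix (Fin d) (Fin d) ℝ => x ⬝ᵥ (X *ᵥ x) :=
  continuous_const.dotProduct (continuous_id.matrix_mulVec continuous_const)

theorem isClosed_loewnerBox (d : ℕ) (ε R : ℝ) : IsClosed (loewnerBox d ε R) := by
  have h : loewnerBox d ε R = {X | Xᴴ = X} ∩ ((⋂ x : Fin d → ℝ, {X | ε * (x ⬝ᵥ x) ≤ x ⬝ᵥ (X *ᵥ x)}) ∩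
      (⋂ x : Fin d → ℝ, {X | x ⬝ᵥ (X *ᵥ x) ≤ R * (x ⬝ᵥ x)})) := by
    ext X
    simp only [loewnerBox, Set.mem_ofPred_eq, smul_one_le_iff, le_smul_one_iff, Set.mem_inter_iff,
      Set.mem_iInter, IsHermitian]
    tauto
  rw [h]
  refine (isClosed_eq continuous_id.matrix_conjTranspose continuous_id).inter
    ((isClosed_iInter fun x => isClosed_le continuous_const (continuous_quadratic x)).inter
      (isClosed_iInter fun x => isClosed_le (continuous_quadratic x) continuous_const))

theorem abs_apply_le_of_mem_loewnerBox (hε : 0 ≤ ε) (hX : X ∈ loewnerBox d ε R) (i j : Fin d) :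
    |X i j| ≤ R := by
  obtain ⟨h1, h2⟩ := hX
  rw [smul_one_le_iff] at h1
  rw [le_smul_one_iff] at h2
  have hs : X j i = X i j := by simpa using h1.1.apply i j
  have hR : ∀ k, X k k ≤ R := fun k => by
    have := h2.2 (Pi.single k 1)
    simpa using this
  -- Testing on eᵢ ± eⱼ gives 2|Xᵢⱼ| ≤ Xᵢᵢ + Xⱼⱼ ≤ 2R.
  have hq : ∀ s : ℝ, 0 ≤ X i i + s * X i j + (s * X i j + s * s * X j j) := fun s => by
    have h := h1.2 (Pi.single i 1 + s • Pi.single j 1)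
    have h0 : 0 ≤ ε * ((Pi.single i 1 + s • Pi.single j 1 : Fin d → ℝ) ⬝ᵥ
        (Pi.single i 1 + s • Pi.single j 1)) :=
      mul_nonneg hε (dotProduct_self_nonneg_real _)
    have h3 := h0.trans h
    simp only [mulVec_add, mulVec_smul, mulVec_single_one, add_dotProduct, dotProduct_add,
      smul_dotProduct, dotProduct_smul, single_one_dotProduct, col_apply, smul_eq_mul, hs] at h3
    linarith
  have := hq 1
  have := hq (-1)
  rw [abs_le]
  constructor <;> linarith [hR i, hR j]

theorem isCompact_loewnerBox (d : ℕ) (hε : 0 ≤ ε) : IsCompact (loewnerBox d ε R) := by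
  have h : IsCompact {X : Fin d → Fin d → ℝ | ∀ i, X i ∈ {y : Fin d → ℝ | ∀ j, y j ∈ Set.Icc (-R) R}} :=
    isCompact_pi_infinite fun _ => isCompact_pi_infinite fun _ => isCompact_Icc
  exact IsCompact.of_isClosed_subset h (isClosed_loewnerBox d ε R) fun X hX i j =>
    abs_le.1 (abs_apply_le_of_mem_loewnerBox hε hX i j)

theorem det_mem_Icc_of_mem_loewnerBox (hε : 0 < ε) (hX : X ∈ loewnerBox d ε R) :
    X.det ∈ Set.Icc (ε ^ d) (R ^ d) := by
  obtain ⟨h1, h2⟩ := hX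
  have hpd := posDef_of_smul_one_le hε h1
  rw [smul_one_le_iff] at h1
  rw [le_smul_one_iff] at h2
  have hH := hpd.isHermitian
  have hev : ∀ i, ε ≤ hH.eigenvalues i ∧ hH.eigenvalues i ≤ R := by
    intro i
    set u : Fin d → ℝ := ⇑(hH.eigenvectorBasis i) with hu
    have hu1 : u ⬝ᵥ u = 1 := by
      rw [hu, EuclideanSpace.dotProduct_ofLp_self, OrthonormalBasis.norm_eq_one, one_pow]
    have hXu : u ⬝ᵥ (X *ᵥ u) = hH.eigenvalues i := by
      rw [hu, hH.mulVec_eigenvectorBasis, ← hu, dotProduct_smul, hu1, smul_eq_mul, mul_one]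
    have h3 := h1.2 u
    have h4 := h2.2 u
    rw [hu1, hXu, mul_one] at h3 h4
    exact ⟨h3, h4⟩
  have hdet : X.det = ∏ i, hH.eigenvalues i := by
    simpa using hH.det_eq_prod_eigenvalues
  rw [hdet]
  constructor
  · calc ε ^ d = ∏ _i : Fin d, ε := by simp
      _ ≤ _ := Finset.prod_le_prod (fun _ _ => hε.le) fun i _ => (hev i).1
  · calc _ ≤ ∏ _i : Fin d, R := Finset.prod_le_prod (fun i _ => hε.le.trans (hev i).1)
          fun i _ => (hev i).2
      _ = R ^ d := by simp

theorem Matrix.PosSemidef.exists_unit_mulVec_eq_zero (hN : N.PosSemidef) (h : ¬ N.PosDef) :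
    ∃ u : Fin d → ℝ, u ⬝ᵥ u = 1 ∧ N *ᵥ u = 0 := by
  obtain ⟨u, hu0, hu⟩ : ∃ u : Fin d → ℝ, u ≠ 0 ∧ N *ᵥ u = 0 := by
    by_contra! hcon
    refine h (PosDef.of_dotProduct_mulVec_pos hN.isHermitian fun x hx => ?_)
    refine lt_of_le_of_ne (hN.dotProduct_mulVec_nonneg x) fun h0 => hcon x hx ?_
    exact (hN.dotProduct_mulVec_zero_iff x).1 h0.symm
  have hpos : 0 < u ⬝ᵥ u := by
    have := dotProduct_star_self_pos_iff.2 hu0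
    simpa using this
  refine ⟨(Real.sqrt (u ⬝ᵥ u))⁻¹ • u, ?_, by rw [mulVec_smul, hu, smul_zero]⟩
  rw [smul_dotProduct, dotProduct_smul, smul_eq_mul, smul_eq_mul, ← mul_assoc, ← mul_inv,
    Real.mul_self_sqrt hpos.le, inv_mul_cancel₀ hpos.ne']

/-- Only the eigenvalue along u changes, from η to η - κ. The proof tests N on the component of x
orthogonal to u. -/
theorem posSemidef_sub_smul_vecMulVec (hN : N.PosSemidef) {u : Fin d → ℝ} {η κ : ℝ}
    (hu : u ⬝ᵥ u = 1) (hNu : N *ᵥ u = η • u) (hκ : κ ≤ η) :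
    (N - κ • vecMulVec u u).PosSemidef := by
  have hP : (vecMulVec u u).IsHermitian := by
    have := (posSemidef_vecMulVec_self_star u).isHermitian
    rwa [star_trivial] at this
  rw [posSemidef_iff_real]
  refine ⟨hN.isHermitian.sub (hP.smul (by simp [IsSelfAdjoint])), fun x => ?_⟩
  have h := (posSemidef_iff_real.1 hN).2 (x - (u ⬝ᵥ x) • u)
  have hNt : Nᵀ = N := by simpa using hN.isHermitian.eq
  have h1 : u ⬝ᵥ (N *ᵥ x) = η * (u ⬝ᵥ x) := by
    rw [dotProduct_mulVec, ← mulVec_transpose, hNt, hNu, smul_dotProduct, smul_eq_mul]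
  simp only [mulVec_sub, mulVec_smul, hNu, sub_dotProduct, dotProduct_sub, smul_dotProduct,
    dotProduct_smul, smul_eq_mul, hu, h1, dotProduct_comm x u] at h
  simp only [sub_mulVec, smul_mulVec, vecMulVec_mulVec, dotProduct_sub, dotProduct_smul,
    smul_eq_mul, dotProduct_comm x u]
  simp only [op_smul_eq_smul, smul_eq_mul]
  nlinarith [mul_self_nonneg (u ⬝ᵥ x)]

/-- A direction with too little variance is stretched by at least 2. For y = T⁻¹u one has α|y|² ≤
⟨y, Ay⟩ = η ≤ α/4, so |y| ≤ 1/2 and ⟨u, T⁻¹u⟩ ≤ 1/2; Young's inequality for T and T⁻¹ concludes. -/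
theorem two_le_dotProduct_transport {α η : ℝ} (hα : 0 < α) (hη : η ≤ α / 4)
    (hT : T.PosDef) (hTXT : T * X * T = A) (hA : α • (1 : Matrix (Fin d) (Fin d) ℝ) ≤ A)
    {u : Fin d → ℝ} (hu : u ⬝ᵥ u = 1) (hXu : X *ᵥ u = η • u) : 2 ≤ u ⬝ᵥ (T *ᵥ u) := by
  have hdet : IsUnit T.det := hT.det_pos.ne'.isUnit
  set y := T⁻¹ *ᵥ u with hy
  have hTy : T *ᵥ y = u := by rw [hy, mulVec_mulVec, mul_nonsing_inv _ hdet, one_mulVec]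
  have h1 := (smul_one_le_iff.1 hA).2 y
  have h2 : y ⬝ᵥ (A *ᵥ y) = η := by
    rw [← hTXT, ← mulVec_mulVec, hTy, ← mulVec_mulVec, hXu, dotProduct_mulVec,
      ← mulVec_transpose, hT.transpose_eq_self, hTy, dotProduct_smul, hu, smul_eq_mul, mul_one]
  rw [h2] at h1
  have h3 := hT.two_mul_dotProduct_le u ((2 : ℝ) • u)
  have h4 := dotProduct_self_nonneg_real (u - (2 : ℝ) • y)
  have h5 : y ⬝ᵥ y ≤ 1 / 4 := by
    by_contra! hcon
    nlinarith
  simp only [sub_dotProduct, dotProduct_sub, smul_dotProduct, dotProduct_smul, hu, smul_eq_mul,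
    dotProduct_comm y u, mulVec_smul, ← hy] at h3 h4
  linarith

/-- A direction with too much variance is shrunk to at most 1/2. For y = Tu, ⟨y, Xy⟩ = ⟨u, Au⟩ ≤ β ≤
η/4, and the X-form is nonnegative at y - u/2. -/
theorem dotProduct_transport_le_half {β η : ℝ} (hη0 : 0 < η) (hη : 4 * β ≤ η)
    (hX : X.PosDef) (hT : T.PosDef) (hTXT : T * X * T = A)
    (hA : A ≤ β • (1 : Matrix (Fin d) (Fin d) ℝ))
    {u : Fin d → ℝ} (hu : u ⬝ᵥ u = 1) (hXu : X *ᵥ u = η • u) : u ⬝ᵥ (T *ᵥ u) ≤ 1 / 2 := by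
  set y := T *ᵥ u with hy
  have h1 := (le_smul_one_iff.1 hA).2 u
  have h2 : u ⬝ᵥ (A *ᵥ u) = y ⬝ᵥ (X *ᵥ y) := by
    rw [← hTXT, ← mulVec_mulVec, ← mulVec_mulVec, dotProduct_mulVec, ← mulVec_transpose,
      hT.transpose_eq_self]
  rw [h2, hu] at h1
  have h3 := (posSemidef_iff_real.1 hX.posSemidef).2 (y - (1 / 2 : ℝ) • u)
  have h4 : u ⬝ᵥ (X *ᵥ y) = η * (u ⬝ᵥ y) := by
    rw [dotProduct_mulVec, ← mulVec_transpose, hX.transpose_eq_self, hXu, smul_dotProduct,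
      smul_eq_mul]
  simp only [mulVec_sub, mulVec_smul, hXu, sub_dotProduct, dotProduct_sub, smul_dotProduct,
    dotProduct_smul, smul_eq_mul, hu, h4, dotProduct_comm y u] at h3
  by_contra! hcon
  nlinarith

/-- Compactness of the unit sphere makes strict positivity of the form persist for small t,
uniformly in the direction. -/
theorem eventually_posSemidef_of_continuous {Y : ℝ → Matrix (Fin d) (Fin d) ℝ} (hY : Continuous Y)
    (hH : ∀ t, (Y t).IsHermitian) (h0 : (Y 0).PosDef) : ∀ᶠ t in nhds (0 : ℝ), (Y t).PosSemidef := by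
  set S : Set (EuclideanSpace ℝ (Fin d)) := Metric.sphere 0 1
  have hS : IsCompact S := isCompact_sphere 0 1
  have hev : ∀ᶠ t in nhds (0 : ℝ), ∀ u ∈ S, 0 < WithLp.ofLp u ⬝ᵥ (Y t *ᵥ WithLp.ofLp u) := by
    refine hS.eventually_forall_of_forall_eventually fun u hu => ?_
    have hc : Continuous fun p : ℝ × EuclideanSpace ℝ (Fin d) =>
        WithLp.ofLp p.2 ⬝ᵥ (Y p.1 *ᵥ WithLp.ofLp p.2) := by
      have h2 : Continuous fun p : ℝ × EuclideanSpace ℝ (Fin d) => WithLp.ofLp p.2 :=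
        (PiLp.continuous_ofLp 2 _).comp continuous_snd
      exact h2.dotProduct ((hY.comp continuous_fst).matrix_mulVec h2)
    refine hc.continuousAt.eventually (lt_mem_nhds ?_)
    have hu0 : WithLp.ofLp u ≠ 0 := by
      intro h
      have : u = 0 := WithLp.ofLp_injective 2 h
      rw [this] at hu
      simp [S] at hu
    simpa using h0.dotProduct_mulVec_pos hu0
  filter_upwards [hev] with t ht
  refine posSemidef_iff_real.2 ⟨hH t, fun x => ?_⟩
  by_cases hx : x = 0
  · simp [hx]
  · set z : EuclideanSpace ℝ (Fin d) := WithLp.toLp 2 x with hz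
    have hz0 : z ≠ 0 := fun h => hx (by simpa [hz] using congrArg WithLp.ofLp h)
    have h1 := ht (‖z‖⁻¹ • z) (by simp [S, norm_smul, hz0])
    simp only [WithLp.ofLp_smul, mulVec_smul, smul_dotProduct, dotProduct_smul, smul_eq_mul] at h1
    have h2 : 0 < ‖z‖⁻¹ := inv_pos.2 (norm_pos_iff.2 hz0)
    exact (pos_of_mul_pos_right (pos_of_mul_pos_right h1 h2.le) h2.le).le

end LoewnerBox

/-! ### Existence of a stationary matrix. -/

section Existence

variable {d n : ℕ} {q γ : ℝ} {w : Fin n → ℝ} {A : Fin n → Matrix (Fin d) (Fin d) ℝ}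
  {X : Matrix (Fin d) (Fin d) ℝ} {α β ε R : ℝ}

/-- Freezing the transport matrices at X, as trial matrices in `two_mul_trace_le`, gives a lower
bound for the objective that is continuous at X and exact there. -/
theorem lowerSemicontinuousOn_matrixObjective (hw0 : ∀ i, 0 ≤ w i) (hA : ∀ i, (A i).PosDef)
    (hε : 0 < ε) : LowerSemicontinuousOn (matrixObjective q γ w A) (loewnerBox d ε R) := by
  intro X hX y hy
  have hXp := posDef_of_smul_one_le hε hX.1
  set ℓ : Matrix (Fin d) (Fin d) ℝ → ℝ := fun Y =>
    ∑ i, 1 / 2 * w i * (Y.trace + (A i).trace - ((transportMatrix X (A i) * Y).trace +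
      ((transportMatrix X (A i))⁻¹ * A i).trace)) + γ * qEntropyOfDet q d Y.det with hℓ
  have hℓX : ℓ X = matrixObjective q γ w A X := by
    simp only [hℓ, matrixObjective]
    congr 1
    refine Finset.sum_congr rfl fun i _ => ?_
    rw [trace_inv_transportMatrix_mul hXp (hA i)]
    ring
  have hcont : ContinuousAt ℓ X := by
    refine ContinuousAt.add (Continuous.continuousAt ?_) (ContinuousAt.mul continuousAt_const ?_)
    · refine continuous_finsetSum _ fun i _ => continuous_const.mul ?_
      exact ((continuous_id.matrix_trace.add continuous_const).sub
        (((continuous_const.matrix_mul continuous_id).matrix_trace).add continuous_const))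
    · exact ContinuousAt.comp (hasDerivAt_qEntropyOfDet hXp.det_pos).continuousAt
        continuous_id.matrix_det.continuousAt
  rw [← hℓX] at hy
  filter_upwards [(hcont.eventually (lt_mem_nhds hy)).filter_mono nhdsWithin_le_nhds,
    self_mem_nhdsWithin] with Y hY hYK
  have hYp := posDef_of_smul_one_le hε hYK.1
  refine hY.trans_le (add_le_add (Finset.sum_le_sum fun i _ =>
    mul_le_mul_of_nonneg_left ?_ (by linarith [hw0 i])) le_rfl)
  have := two_mul_trace_le (hXp.transportMatrix (hA i)) (hYp.transportMatrix (hA i)).isHermitian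
    hYp (transportMatrix_mul_mul hYp (hA i))
  linarith

theorem congrPath_smul_vecMulVec (hX : X.PosDef) {u : Fin d → ℝ} {η : ℝ} (hu : u ⬝ᵥ u = 1)
    (hXu : X *ᵥ u = η • u) (σ t : ℝ) :
    congrPath X (σ • vecMulVec u u) t =
      X + ((2 * (t * σ) + (t * σ) ^ 2) * η) • vecMulVec u u := by
  have hP : (vecMulVec u u)ᵀ = vecMulVec u u := transpose_vecMulVec u u
  have h1 : X * vecMulVec u u = η • vecMulVec u u := by
    rw [mul_vecMulVec, hXu, smul_vecMulVec]
  have h2 : vecMulVec u u * X = η • vecMulVec u u := by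
    have := congrArg Matrix.transpose h1
    rwa [transpose_mul, transpose_smul, hP, hX.transpose_eq_self] at this
  have h3 : vecMulVec u u * vecMulVec u u = vecMulVec u u := by
    rw [vecMulVec_mul_vecMulVec, hu]
    simp
  rw [congrPath, smul_smul]
  simp only [transpose_add, transpose_one, transpose_smul, hP, add_mul, mul_add, one_mul, mul_one,
    smul_mul_assoc, mul_smul_comm, h1, h2, h3, smul_smul]
  module

theorem trace_vecMulVec_mul (u : Fin d → ℝ) (N : Matrix (Fin d) (Fin d) ℝ) :
    (vecMulVec u u * N).trace = u ⬝ᵥ (N *ᵥ u) := by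
  rw [vecMulVec_mul, trace_vecMulVec, dotProduct_mulVec, dotProduct_comm]

theorem dotProduct_stationary (hX : X.PosDef) {u : Fin d → ℝ} {η : ℝ}
    (hu : u ⬝ᵥ u = 1) (hXu : X *ᵥ u = η • u) (c : ℝ) :
    u ⬝ᵥ ((X - X * meanTransport w A X - c • 1) *ᵥ u) =
      η * (1 - ∑ i, w i * (u ⬝ᵥ (transportMatrix X (A i) *ᵥ u))) - c := by
  have h1 : u ⬝ᵥ ((X * meanTransport w A X) *ᵥ u) =
      η * ∑ i, w i * (u ⬝ᵥ (transportMatrix X (A i) *ᵥ u)) := by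
    rw [← mulVec_mulVec, dotProduct_mulVec, ← mulVec_transpose, hX.transpose_eq_self, hXu,
      smul_dotProduct, smul_eq_mul, meanTransport, sum_mulVec, dotProduct_sum]
    simp only [smul_mulVec, dotProduct_smul, smul_eq_mul]
  rw [sub_mulVec, sub_mulVec, dotProduct_sub, dotProduct_sub, h1, hXu, dotProduct_smul_one_mulVec,
    dotProduct_smul, hu, smul_eq_mul]
  ring

/-- Since d(q-1)/2 < 1, the power of R on the left grows sublinearly. The outcome keeps the
stationary multiplier below R/2 on the whole box. -/
theorem exists_large_radius (hd : 1 ≤ d) (hq : q < ((d : ℝ) + 4) / ((d : ℝ) + 2)) (c a b : ℝ) :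
    ∃ R : ℝ, b < R ∧ 2 * (c * (a + (R ^ d) ^ ((q - 1) / 2))) < R := by
  have hsd : (q - 1) / 2 * d < 1 := by
    have hd0 : (1 : ℝ) ≤ d := by exact_mod_cast hd
    have := qC1_denom_pos hq
    rcases le_or_gt q 1 with hq2 | hq2 <;> nlinarith
  set p := (q - 1) / 2 * d with hp
  have h1 : Filter.Tendsto (fun R : ℝ => 2 * (c * (a * R⁻¹ + R ^ (-(1 - p))))) Filter.atTop
      (nhds (2 * (c * (a * 0 + 0)))) :=
    (((tendsto_inv_atTop_zero.const_mul a).add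
      (tendsto_rpow_neg_atTop (by linarith))).const_mul c).const_mul 2
  simp only [mul_zero, add_zero] at h1
  have h2 := h1.eventually (gt_mem_nhds zero_lt_one)
  obtain ⟨R, hR1, hR2, hR3⟩ := (h2.and ((Filter.eventually_gt_atTop b).and
    (Filter.eventually_gt_atTop 0))).exists
  refine ⟨R, hR2, ?_⟩
  have h3 : (R ^ d) ^ ((q - 1) / 2) = R ^ (-(1 - p)) * R := by
    rw [← Real.rpow_natCast, ← Real.rpow_mul hR3.le, ← Real.rpow_add_one hR3.ne']
    congr 1
    rw [hp]
    ring
  have h4 := mul_lt_mul_of_pos_right hR1 hR3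
  rw [h3]
  have h5 : 2 * (c * (a * R⁻¹ + R ^ (-(1 - p)))) * R = 2 * (c * (a + R ^ (-(1 - p)) * R)) := by
    field_simp
  linarith

/-- The sum of the endpoint values covers both monotonicities of the power, hence both signs of q -
1. -/
theorem rpow_le_add_of_mem_Icc {x a b : ℝ} (ha : 0 < a) (hx : x ∈ Set.Icc a b) (s : ℝ) :
    x ^ s ≤ a ^ s + b ^ s := by
  have hx0 : 0 < x := ha.trans_le hx.1
  have hb : 0 < b := hx0.trans_le hx.2
  have h1 := Real.rpow_nonneg ha.le s
  have h2 := Real.rpow_nonneg hb.le s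
  rcases le_total s 0 with hs | hs
  · linarith [Real.rpow_le_rpow_of_nonpos ha hx.1 hs]
  · linarith [Real.rpow_le_rpow hx0.le hx.2 hs]

theorem exists_stationary (hd : 1 ≤ d) (hq : q < ((d : ℝ) + 4) / ((d : ℝ) + 2)) (hα : 0 < α)
    (hγ : 0 ≤ γ) (hw0 : ∀ i, 0 ≤ w i) (hw : ∑ i, w i = 1)
    (hA : ∀ i, α • (1 : Matrix (Fin d) (Fin d) ℝ) ≤ A i ∧
      A i ≤ β • (1 : Matrix (Fin d) (Fin d) ℝ)) :
    ∃ X : Matrix (Fin d) (Fin d) ℝ, X.PosDef ∧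
      X - X * meanTransport w A X = stationaryMultiplier q γ X • 1 := by
  have hAp : ∀ i, (A i).PosDef := fun i => posDef_of_smul_one_le hα (hA i).1
  have hm := qM_pos hd hq
  have hγm : 0 ≤ γ * qM q d := mul_nonneg hγ hm.le
  -- The values α/4 and 4β are the thresholds at which the transport matrices stretch by 2 or shrink
  -- to 1/2; R must also exceed twice the multiplier.
  set ε := α / 4 with hεdef
  have hε : 0 < ε := by positivity
  obtain ⟨R, hR, hRc⟩ := exists_large_radius hd hq (γ * qM q d) ((ε ^ d) ^ ((q - 1) / 2))
    (max ε (4 * β))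
  have hRε : ε < R := (le_max_left _ _).trans_lt hR
  have hRβ : 4 * β < R := (le_max_right _ _).trans_lt hR
  have hR0 : 0 < R := hε.trans hRε
  have hne : (loewnerBox d ε R).Nonempty := by
    refine ⟨ε • 1, le_rfl, ?_⟩
    rw [Matrix.le_iff, ← sub_smul]
    exact PosSemidef.one.smul (sub_nonneg.2 hRε.le)
  obtain ⟨X, hXK, hmin⟩ := (lowerSemicontinuousOn_matrixObjective (q := q) (γ := γ) (R := R)
    hw0 hAp hε).exists_isMinOn hne (isCompact_loewnerBox d hε.le)
  have hX := posDef_of_smul_one_le hε hXK.1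
  set c := stationaryMultiplier q γ X with hc
  have hc0 : 0 ≤ c := mul_nonneg hγm (Real.rpow_nonneg hX.det_pos.le _)
  have hcR : 2 * c < R := by
    refine lt_of_le_of_lt ?_ hRc
    have := rpow_le_add_of_mem_Icc (by positivity) (det_mem_Icc_of_mem_loewnerBox hε hXK)
      ((q - 1) / 2)
    exact mul_le_mul_of_nonneg_left (mul_le_mul_of_nonneg_left this hγm) two_pos.le
  have hpsd : ∀ u : Fin d → ℝ, (vecMulVec u u).PosSemidef := fun u => by
    simpa only [star_trivial] using posSemidef_vecMulVec_self_star u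
  have hsmall : ∀ b : ℝ, ∀ᶠ t in nhdsWithin (0 : ℝ) (Set.Ioi 0),
      t ∈ Set.Ioo (0 : ℝ) 1 ∧ (2 * t + t ^ 2) * b ≤ R - ε ∧ (2 * t - t ^ 2) * b ≤ R - ε := by
    intro b
    have h1 : ∀ᶠ t in nhds (0 : ℝ), t < 1 ∧ (2 * t + t ^ 2) * b < R - ε ∧
        (2 * t - t ^ 2) * b < R - ε := by
      have hc1 : Continuous fun t : ℝ => (2 * t + t ^ 2) * b := by fun_prop
      have hc2 : Continuous fun t : ℝ => (2 * t - t ^ 2) * b := by fun_prop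
      exact (gt_mem_nhds zero_lt_one).and
        ((hc1.continuousAt.eventually (gt_mem_nhds (by simpa using hRε))).and
          (hc2.continuousAt.eventually (gt_mem_nhds (by simpa using hRε))))
    filter_upwards [h1.filter_mono nhdsWithin_le_nhds, self_mem_nhdsWithin] with t ht ht0
    exact ⟨⟨ht0, ht.1⟩, ht.2.1.le, ht.2.2.le⟩
  have hsumle : ∀ f : Fin n → ℝ, (∀ i, f i ≤ 1 / 2) → ∑ i, w i * f i ≤ 1 / 2 := fun f hf =>
    calc ∑ i, w i * f i ≤ ∑ i, w i * (1 / 2) :=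
          Finset.sum_le_sum fun i _ => mul_le_mul_of_nonneg_left (hf i) (hw0 i)
      _ = 1 / 2 := by rw [← Finset.sum_mul, hw, one_mul]
  have hsumge : ∀ f : Fin n → ℝ, (∀ i, 2 ≤ f i) → 2 ≤ ∑ i, w i * f i := fun f hf =>
    calc 2 = ∑ i, w i * 2 := by rw [← Finset.sum_mul, hw, one_mul]
      _ ≤ ∑ i, w i * f i :=
          Finset.sum_le_sum fun i _ => mul_le_mul_of_nonneg_left (hf i) (hw0 i)
  -- Were ε an eigenvalue, raising it would be admissible, so ε(1 - Σ) - c ≥ 0, where Σ is the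
  -- weighted stretch and c the multiplier; but Σ ≥ 2 and c ≥ 0.
  have hlow : (X - ε • 1).PosDef := by
    by_contra hcon
    obtain ⟨u, hu, hNu⟩ := PosSemidef.exists_unit_mulVec_eq_zero (Matrix.le_iff.1 hXK.1) hcon
    have hXu : X *ᵥ u = ε • u := by
      rwa [sub_mulVec, smul_mulVec, one_mulVec, sub_eq_zero] at hNu
    have hvar := trace_mul_stationary_nonneg hw0 hw hAp hX hmin (H := (1 : ℝ) • vecMulVec u u) (by
      filter_upwards [hsmall ε] with t ht
      rw [congrPath_smul_vecMulVec hX hu hXu]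
      simp only [mul_one]
      constructor
      · rw [Matrix.le_iff, add_sub_right_comm]
        refine (Matrix.le_iff.1 hXK.1).add ((hpsd u).smul ?_)
        have := ht.1.1
        positivity
      · rw [Matrix.le_iff, ← sub_sub]
        refine posSemidef_sub_smul_vecMulVec (Matrix.le_iff.1 hXK.2) hu (η := R - ε) ?_ ht.2.1
        rw [sub_mulVec, hXu, smul_mulVec, one_mulVec, sub_smul])
    rw [one_smul, trace_vecMulVec_mul, dotProduct_stationary hX hu hXu] at hvar
    have := hsumge (fun i => u ⬝ᵥ (transportMatrix X (A i) *ᵥ u)) fun i =>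
      two_le_dotProduct_transport hα le_rfl (hX.transportMatrix (hAp i))
        (transportMatrix_mul_mul hX (hAp i)) (hA i).1 hu hXu
    nlinarith
  -- Were R an eigenvalue, lowering it would be admissible, so R(1 - Σ) ≤ c; but Σ ≤ 1/2 and 2c < R.
  have hhigh : (R • 1 - X).PosDef := by
    by_contra hcon
    obtain ⟨u, hu, hNu⟩ := PosSemidef.exists_unit_mulVec_eq_zero (Matrix.le_iff.1 hXK.2) hcon
    have hXu : X *ᵥ u = R • u := by
      rw [sub_mulVec, smul_mulVec, one_mulVec, sub_eq_zero] at hNu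
      exact hNu.symm
    have hvar := trace_mul_stationary_nonneg hw0 hw hAp hX hmin (H := (-1 : ℝ) • vecMulVec u u) (by
      filter_upwards [hsmall R] with t ht
      rw [congrPath_smul_vecMulVec hX hu hXu,
        show (2 * (t * -1) + (t * -1) ^ 2) * R = -((2 * t - t ^ 2) * R) by ring, neg_smul,
        ← sub_eq_add_neg]
      constructor
      · rw [Matrix.le_iff, sub_right_comm]
        refine posSemidef_sub_smul_vecMulVec (Matrix.le_iff.1 hXK.1) hu (η := R - ε) ?_ ht.2.2
        rw [sub_mulVec, hXu, smul_mulVec, one_mulVec, sub_smul]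
      · rw [Matrix.le_iff, ← sub_add]
        refine (Matrix.le_iff.1 hXK.2).add ((hpsd u).smul ?_)
        have h1 := ht.1.1
        have h2 := ht.1.2
        refine mul_nonneg ?_ hR0.le
        nlinarith)
    rw [neg_one_smul, neg_mul, trace_neg, trace_vecMulVec_mul, dotProduct_stationary hX hu hXu]
      at hvar
    have := hsumle (fun i => u ⬝ᵥ (transportMatrix X (A i) *ᵥ u)) fun i =>
      dotProduct_transport_le_half hR0 hRβ.le hX (hX.transportMatrix (hAp i))
        (transportMatrix_mul_mul hX (hAp i)) (hA i).2 hu hXu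
    nlinarith
  have hmem : ∀ H : Matrix (Fin d) (Fin d) ℝ,
      ∀ᶠ t in nhdsWithin (0 : ℝ) (Set.Ioi 0), congrPath X H t ∈ loewnerBox d ε R := by
    intro H
    have hcont : Continuous (congrPath X H) := by
      have h1 : Continuous fun t : ℝ => 1 + t • H := by fun_prop
      exact (h1.matrix_mul continuous_const).matrix_mul h1.matrix_transpose
    have hherm : ∀ t, (congrPath X H t).IsHermitian := fun t => by
      have := isHermitian_mul_mul_conjTranspose (1 + t • H) hX.isHermitian
      rwa [conjTranspose_eq_transpose_of_trivial] at this
    have hone : ∀ r : ℝ, (r • (1 : Matrix (Fin d) (Fin d) ℝ)).IsHermitian := fun r =>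
      isHermitian_one.smul (by simp [IsSelfAdjoint])
    have h0 : congrPath X H 0 = X := by simp [congrPath]
    have e1 := eventually_posSemidef_of_continuous (hcont.sub continuous_const)
      (fun t => (hherm t).sub (hone ε)) (by simpa only [Pi.sub_apply, h0] using hlow)
    have e2 := eventually_posSemidef_of_continuous (continuous_const.sub hcont)
      (fun t => (hone R).sub (hherm t)) (by simpa only [Pi.sub_apply, h0] using hhigh)
    filter_upwards [(e1.and e2).filter_mono nhdsWithin_le_nhds] with t ht
    exact ht
  refine ⟨X, hX, ?_⟩
  set N := X - X * meanTransport w A X - c • (1 : Matrix (Fin d) (Fin d) ℝ) with hN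
  -- Every direction is now admissible. Moving against the gradient gives -tr(NᵀN) ≥ 0, hence N = 0;
  -- no symmetry of N is needed.
  have hvar := trace_mul_stationary_nonneg hw0 hw hAp hX hmin (hmem (-Nᵀ))
  rw [← hc, ← hN, neg_mul, trace_neg] at hvar
  have hNN : (Nᴴ * N).trace = 0 := by
    refine le_antisymm ?_ (posSemidef_conjTranspose_mul_self N).trace_nonneg
    rw [conjTranspose_eq_transpose_of_trivial]
    linarith
  rw [trace_conjTranspose_mul_self_eq_zero_iff] at hNN
  rwa [hN, sub_eq_zero] at hNN

/-! ### Return from matrices to measures. -/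

/-- Conjugating the stationarity equation as X^(-1/2)(·)X^(1/2) fixes X and the identity, and turns
X times the mean transport into the sum of square roots. -/
theorem sub_smul_one_eq_sum_sqrt (hX : X.PosDef)
    (hXeq : X - X * meanTransport w A X = stationaryMultiplier q γ X • 1) :
    X - (γ * qM q d * X.det ^ ((q - 1) / 2)) • (1 : Matrix (Fin d) (Fin d) ℝ) =
      ∑ i, w i • CFC.sqrt (CFC.sqrt X * A i * CFC.sqrt X) := by
  have hu : IsUnit (CFC.sqrt X).det := hX.posDef_sqrt.det_pos.ne'.isUnit
  have hS := CFC.sqrt_mul_sqrt_self X hX.posSemidef.nonneg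
  have h1 : ∑ i, w i • CFC.sqrt (CFC.sqrt X * A i * CFC.sqrt X) =
      CFC.sqrt X * meanTransport w A X * CFC.sqrt X := by
    rw [meanTransport, Finset.mul_sum, Finset.sum_mul]
    refine Finset.sum_congr rfl fun i _ => ?_
    rw [← sqrt_mul_transportMatrix_mul_sqrt hX, mul_smul_comm, smul_mul_assoc]
  have h2 : (CFC.sqrt X)⁻¹ * (X * meanTransport w A X) * CFC.sqrt X =
      CFC.sqrt X * meanTransport w A X * CFC.sqrt X := by
    nth_rewrite 2 [← hS]
    rw [mul_assoc (CFC.sqrt X) (CFC.sqrt X), ← mul_assoc (CFC.sqrt X)⁻¹, nonsing_inv_mul _ hu,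
      one_mul]
  have h3 : (CFC.sqrt X)⁻¹ * X * CFC.sqrt X = X := by
    have : (CFC.sqrt X)⁻¹ * X = CFC.sqrt X := by
      nth_rewrite 2 [← hS]
      rw [← mul_assoc, nonsing_inv_mul _ hu, one_mul]
    rw [this, hS]
  have h4 : X * meanTransport w A X = X - stationaryMultiplier q γ X • 1 := by
    rw [← hXeq]
    abel
  rw [h1, ← h2, h4, mul_sub, sub_mul, h3, mul_smul_comm, smul_mul_assoc, mul_one,
    nonsing_inv_mul _ hu, stationaryMultiplier]

theorem penalizedObjective_qGaussian (hd : 1 ≤ d) (hq : q < ((d : ℝ) + 4) / ((d : ℝ) + 2))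
    (hw0 : ∀ i, 0 ≤ w i) (hw : ∑ i, w i = 1) (hA : ∀ i, (A i).PosDef)
    (v : EuclideanSpace ℝ (Fin d)) (hX : X.PosDef) :
    penalizedObjective q γ w (fun i => qGaussian q 0 (A i)) (qGaussian q v X) =
      ((1 / 2 * ‖v‖ ^ 2 + matrixObjective q γ w A X : ℝ) : EReal) := by
  have hnn : ∀ i, 0 ≤ ‖v‖ ^ 2 + X.trace + (A i).trace -
      2 * (transportMatrix X (A i) * X).trace := by
    intro i
    -- The trial matrix W = 1 gives 2 tr(TX) ≤ tr X + tr A, so `ENNReal.ofReal` does not truncate.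
    have := two_mul_trace_le (PosDef.one (n := Fin d)) (hX.transportMatrix (hA i)).isHermitian hX
      (transportMatrix_mul_mul hX (hA i))
    rw [inv_one, one_mul, one_mul] at this
    have := sq_nonneg ‖v‖
    linarith
  have hsum : ∑ i, ENNReal.ofReal (1 / 2 * w i) * wassersteinSq (qGaussian q v X)
      (qGaussian q 0 (A i)) = ENNReal.ofReal (∑ i, 1 / 2 * w i * (‖v‖ ^ 2 + X.trace + (A i).trace -
        2 * (transportMatrix X (A i) * X).trace)) := by
    rw [ENNReal.ofReal_sum_of_nonneg fun i _ => mul_nonneg (by linarith [hw0 i]) (hnn i)]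
    refine Finset.sum_congr rfl fun i _ => ?_
    rw [wassersteinSq_qGaussian hd hq v hX (hA i) (hX.transportMatrix (hA i))
      (transportMatrix_mul_mul hX (hA i)), ← ENNReal.ofReal_mul (by linarith [hw0 i])]
  rw [penalizedObjective, hsum, (tsallis_qGaussian hd hq v hX).2, EReal.coe_ennreal_ofReal,
    max_eq_left (Finset.sum_nonneg fun i _ => mul_nonneg (by linarith [hw0 i]) (hnn i)),
    ← EReal.coe_add]
  congr 1
  rw [matrixObjective, ← add_assoc]
  congr 1
  have h1 : 1 / 2 * ‖v‖ ^ 2 = ∑ i, 1 / 2 * w i * ‖v‖ ^ 2 := by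
    rw [← Finset.sum_mul, ← Finset.mul_sum, hw, mul_one]
  rw [h1, ← Finset.sum_add_distrib]
  exact Finset.sum_congr rfl fun i _ => by ring

theorem hasUniqueQGaussianBarycenter (hd : 1 ≤ d) (hq : q < ((d : ℝ) + 4) / ((d : ℝ) + 2))
    (hα : 0 < α) (hγ : 0 ≤ γ) (hw0 : ∀ i, 0 ≤ w i) (hw : ∑ i, w i = 1)
    (hA : ∀ i, α • (1 : Matrix (Fin d) (Fin d) ℝ) ≤ A i ∧
      A i ≤ β • (1 : Matrix (Fin d) (Fin d) ℝ)) :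
    HasUniqueQGaussianBarycenter q γ w A := by
  have hAp : ∀ i, (A i).PosDef := fun i => posDef_of_smul_one_le hα (hA i).1
  obtain ⟨X, hX, hXeq⟩ := exists_stationary hd hq hα hγ hw0 hw hA
  refine ⟨X, hX, ⟨⟨0, X, hX, rfl⟩, ?_⟩, ?_, covariance_coord_qGaussian hd hq hX,
    sub_smul_one_eq_sum_sqrt hX hXeq⟩
  · rintro ν ⟨v, V, hV, rfl⟩
    rw [penalizedObjective_qGaussian hd hq hw0 hw hAp 0 hX,
      penalizedObjective_qGaussian hd hq hw0 hw hAp v hV, EReal.coe_le_coe_iff]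
    have := matrixObjective_le_of_stationary hd hq hγ hw0 hw hAp hX hXeq hV
    have := sq_nonneg ‖v‖
    simp only [norm_zero]
    linarith
  · rintro ν ⟨⟨v, V, hV, rfl⟩, hmin⟩
    have h := hmin _ ⟨0, X, hX, rfl⟩
    rw [penalizedObjective_qGaussian hd hq hw0 hw hAp 0 hX,
      penalizedObjective_qGaussian hd hq hw0 hw hAp v hV, EReal.coe_le_coe_iff, norm_zero] at h
    have h1 := matrixObjective_le_of_stationary hd hq hγ hw0 hw hAp hX hXeq hV
    have h2 := sq_nonneg ‖v‖
    have hv : v = 0 := by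
      rw [← norm_eq_zero]
      have : ‖v‖ ^ 2 = 0 := le_antisymm (by linarith) h2
      exact pow_eq_zero_iff two_ne_zero |>.1 this
    have hVX : V = X := eq_of_matrixObjective_le_of_stationary hd hq hγ hw0 hw hAp hX hXeq hV
      (by linarith)
    rw [hv, hVX]

end Existence

theorem theorem4p1 (d : ℕ) (hd : 1 ≤ d) (q : ℝ) (hq0 : 0 < q)
    (hq : q < ((d : ℝ) + 4) / ((d : ℝ) + 2)) (α β : ℝ) (hα : 0 < α) (hαβ : α ≤ β) :
    (∀ μ ∈ qGaussians d q, Integrable (tsallisIntegrand q μ) volume) ∧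
    ((q ≤ 1 ∨ (1 < q ∧ q ≤ 1 + 2 * α ^ 2 / ((d : ℝ) * β ^ 2))) →
      ∀ (n : ℕ) (w : Fin n → ℝ) (A : Fin n → Matrix (Fin d) (Fin d) ℝ),
        (∀ i, 0 ≤ w i) → ∑ i, w i = 1 →
        (∀ i, α • (1 : Matrix (Fin d) (Fin d) ℝ) ≤ A i ∧
          A i ≤ β • (1 : Matrix (Fin d) (Fin d) ℝ)) →
        ∀ γ : ℝ, 0 ≤ γ → HasUniqueQGaussianBarycenter q γ w A) ∧
    (1 + 2 * α ^ 2 / ((d : ℝ) * β ^ 2) < q →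
      ∃ γ₀ : ℝ, 0 < γ₀ ∧
        ∀ (n : ℕ) (w : Fin n → ℝ) (A : Fin n → Matrix (Fin d) (Fin d) ℝ),
          (∀ i, 0 ≤ w i) → ∑ i, w i = 1 →
          (∀ i, α • (1 : Matrix (Fin d) (Fin d) ℝ) ≤ A i ∧
            A i ≤ β • (1 : Matrix (Fin d) (Fin d) ℝ)) →
          ∀ γ : ℝ, 0 ≤ γ → γ < γ₀ → HasUniqueQGaussianBarycenter q γ w A) := by
  refine ⟨?_, ?_, ?_⟩
  · rintro μ ⟨v, V, hV, rfl⟩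
    exact (tsallis_qGaussian hd hq v hV).1
  · intro _ n w A hw0 hw hA γ hγ
    exact hasUniqueQGaussianBarycenter hd hq hα hγ hw0 hw hA
  · intro _
    -- Any positive number serves as γ₀, as the preceding theorem covers all γ ≥ 0.
    exact ⟨1, one_pos, fun n w A hw0 hw hA γ hγ _ =>
      hasUniqueQGaussianBarycenter hd hq hα hγ hw0 hw hA⟩
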